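/- Let $X$ be a real-valued random variable on a probability space. For $\alpha\in[0,\infty]$ and $u\in\mathbb R$ put $h_\alpha(u)=\mathbf 1\{u\ge 0\}$ if $\alpha=0$, $h_\alpha(u)=\max(0,1+u/\alpha)^\alpha$ if $0<\alpha<\infty$, and $h_\alpha(u)=e^u$ if $\alpha=\infty$. For $x\in\mathbb R$ and $p\in(0,1)$ let $$P_\alpha(X;x)=\inf_{\lambda>0}\mathsf E\,h_\alpha\big(\lambda(X-x)\big)\in[0,\infty],\qquad Q_\alpha(X;p)=\inf\{x\in\mathbb R: P_\alpha(X;x)<p\}\in[-\infty,\infty],$$ so that $P_0(X;x)=\mathsf P(X\ge x)$. Let $x_*=\sup\operatorname{supp}X$ be the supremum of the support of the distribution of $X$. For $r\in(0,\infty]$, a function $q\colon\mathbb R\to\mathbb R$ is said to be *like* $x^{-r}$ if there is a positive twice differentiable function $q_0$ on $\mathbb R$ such that $$\frac{q(x)}{q_0(x)}\to 1\quad\text{and}\quad \frac{q_0(x)\,q_0''(x)}{q_0'(x)^2}\to 1+\frac1r\qquad\text{as }x\to\infty,$$ where $1/\infty=0$. **Proposition.** Let $\alpha\in[0,\infty]$.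 (i) If $x_*<\infty$, then $x_*\in\mathbb R$ and $\lim_{p\downarrow0}Q_\alpha(X;p)=\lim_{p\downarrow0}Q_0(X;p)=x_*$. (ii) If $x\mapsto\mathsf P(X\ge x)$ is like $x^{-r}$ for some $r\in(\alpha,\infty]$ (so that $\alpha<\infty$), then $x_*=\infty$; $Q_\alpha(X;p)$ and $Q_0(X;p)$ are real for every $p\in(0,1)$; $Q_\alpha(X;p)\to\infty$ as $p\downarrow0$; and $$\frac{Q_\alpha(X;p)}{K(r,\alpha)\,Q_0(X;p)}\to1\qquad\text{as }p\downarrow0,$$ where $K(r,\alpha)=1$ if $r=\infty$, and $K(r,\alpha)=c_{r,\alpha}^{1/r}$ if $r<\infty$, with $$c_{r,\alpha}=\frac{\Gamma(\alpha+1)\,\Gamma(r-\alpha)}{\Gamma(r)}\;\frac{r^r}{\alpha^\alpha\,(r-\alpha)^{r-\alpha}},$$ $\Gamma$ the Gamma function, and $0^0=1$ in this formula (so that $c_{r,0}=1$). -/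

import Mathlib

open MeasureTheory Filter Topology Set
open scoped ENNReal

noncomputable section

namespace QuantileBounds

/-- The generalized moment functions `h_α`, `α ∈ [0, ∞]`: the indicator of `[0, ∞)` for `α = 0`,
`u ↦ (1 + u / α)_+ ^ α` for `0 < α < ∞`, and `u ↦ e ^ u` for `α = ∞`. -/
def h (α : ℝ≥0∞) (u : ℝ) : ℝ :=
  if α = 0 then (if 0 ≤ u then 1 else 0)
  else if α = ⊤ then Real.exp u
  else (max 0 (1 + u / α.toReal)) ^ α.toReal

variable {Ω : Type*} [MeasurableSpace Ω]

/-- `A_α(X; x)(l) = E h_α(l (X - x))`, with values in `[0, ∞]`. -/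
def A (μ : Measure Ω) (X : Ω → ℝ) (α : ℝ≥0∞) (x l : ℝ) : ℝ≥0∞ :=
  ∫⁻ ω, ENNReal.ofReal (h α (l * (X ω - x))) ∂μ

/-- The bound `P_α(X; x) = inf_{l > 0} A_α(X; x)(l)` on the tail probability `P(X ≥ x)`. -/
def P (μ : Measure Ω) (X : Ω → ℝ) (α : ℝ≥0∞) (x : ℝ) : ℝ≥0∞ :=
  ⨅ l ∈ Ioi (0 : ℝ), A μ X α x l

/-- The quantile bound `Q_α(X; p) = inf {x ∈ ℝ : P_α(X; x) < p}`, the infimum being taken in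
`[-∞, ∞]`; `Q_0(X; p)` is the largest `(1 - p)`-quantile of `X`. -/
def Q (μ : Measure Ω) (X : Ω → ℝ) (α : ℝ≥0∞) (p : ℝ) : EReal :=
  sInf ((fun x : ℝ => (x : EReal)) '' {x : ℝ | P μ X α x < ENNReal.ofReal p})

/-- `x_* = sup supp X`, the supremum (in `[-∞, ∞]`) of the support of the distribution of `X`. -/
def xStar (μ : Measure Ω) (X : Ω → ℝ) : EReal :=
  sSup ((fun x : ℝ => (x : EReal)) '' (μ.map X).support)

/-- `q(x)` is like `x ^ (-r)`, for `r ∈ (0, ∞]`: there is a positive twice differentiable function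
`q₀` on `ℝ` such that `q(x) ∼ q₀(x)` and `q₀(x) q₀''(x) / q₀'(x) ^ 2 → 1 + 1 / r` as `x → ∞`
(where `1 / ∞ = 0`). As the second limit is positive, `q₀'` vanishes at no large `x`. -/
def IsLike (q : ℝ → ℝ) (r : ℝ≥0∞) : Prop :=
  ∃ q₀ : ℝ → ℝ, (∀ x, 0 < q₀ x) ∧ Differentiable ℝ q₀ ∧ Differentiable ℝ (deriv q₀) ∧
    Tendsto (fun x => q x / q₀ x) atTop (𝓝 1) ∧
    Tendsto (fun x => q₀ x * deriv (deriv q₀) x / (deriv q₀ x) ^ 2) atTop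
      (𝓝 (1 + (r⁻¹).toReal))

/-- `c_{r, α} = Γ(α + 1) Γ(r - α) / Γ(r) * r ^ r / (α ^ α (r - α) ^ (r - α))` for real
`0 ≤ α < r`; here `0 ^ 0 = 1`, so that `c_{r, 0} = 1`. -/
def c (r α : ℝ) : ℝ :=
  Real.Gamma (α + 1) * Real.Gamma (r - α) / Real.Gamma r *
    (r ^ r / (α ^ α * (r - α) ^ (r - α)))

/-- `K(r, α) = 1` if `r = ∞`, and `K(r, α) = c_{r, α} ^ (1 / r)` if `r < ∞`. -/
def K (r α : ℝ≥0∞) : ℝ :=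
  if r = ⊤ then 1 else (c r.toReal α.toReal) ^ (1 / r.toReal)

end QuantileBounds

end

namespace QuantileBounds

/-! Write `q(x) = P(X ≥ x)` and `a = α`. Part (ii) reduces to comparing `P_α(X; κz)` with `q(z)` for
large `z`: `P_α(X; κz) ≤ q(z)` for each `κ > K` and `≥` for each `0 < κ < K` give `Q_α ≤ κ Q_0`,
respectively `Q_α ≥ κ Q_0`, for small `p` (`Q_asymptotics`).

For `0 < a < ∞`, the substitution `l = a / (x (1 - θ))` gives `P_α(X; x) = inf_{θ < 1} (1 - θ)^(-a)
E (X/x - θ)_+^a` when `x > 0`. The likeness condition yields Potter bounds on `q`, hence `q(xs)/q(x)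
→ s^(-r)`. Dominated convergence then gives `E (X/y - 1)_+^a ∼ J q(y)` with `J = Γ(a+1)Γ(r-a)/Γ(r)`.
So at `x = κz` and fixed `θ ∈ (0, 1)` the objective is asymptotic to `J κ^(-r) (1 - θ)^(-a) θ^(a-r)
q(z)`, whose minimum, at `θ = (r - a)/r`, is `c κ^(-r) q(z)`; this is below `q(z)` exactly when `κ >
c^(1/r) = K`. The upper bound uses this one `θ` (`eventually_P_le`); the lower bound needs all `θ <
1` at once, by compactness on `[δ, 1]` and Markov's inequality for `θ ≤ δ` (`eventually_le_P`). If
`r = ∞`, the moment is `o(q)` and `K = 1`.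

Part (i) is soft: every `m < x_*` has a positive tail, and `P_α` vanishes beyond `x_*`. -/

theorem eventually_pos_of_tendsto_deriv {ψ ψ' : ℝ → ℝ} {d : ℝ} (hd : 0 < d)
    (hψ : ∀ᶠ x in atTop, HasDerivAt ψ (ψ' x) x) (hlim : Tendsto ψ' atTop (𝓝 d)) :
    ∀ᶠ x in atTop, 0 < ψ x := by
  obtain ⟨x₁, hx₁⟩ := eventually_atTop.1
    (hψ.and (hlim.eventually (lt_mem_nhds (half_lt_self hd))))
  have key : ∀ x, x₁ ≤ x → d / 2 * (x - x₁) ≤ ψ x - ψ x₁ := by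
    intro x hx
    refine (convex_Ici x₁).mul_sub_le_image_sub_of_le_deriv
      (fun y hy => (hx₁ y hy).1.continuousAt.continuousWithinAt)
      (fun y hy => (hx₁ y (interior_subset hy)).1.differentiableAt.differentiableWithinAt)
      (fun y hy => ?_) x₁ self_mem_Ici x hx hx
    rw [(hx₁ y (interior_subset hy)).1.deriv]
    exact (hx₁ y (interior_subset hy)).2.le
  filter_upwards [eventually_ge_atTop x₁, eventually_gt_atTop (x₁ - 2 * ψ x₁ / d)] with x h1 h2
  have h3 := key x h1
  have h4 : d / 2 * (-(2 * ψ x₁ / d)) < d / 2 * (x - x₁) := by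
    apply mul_lt_mul_of_pos_left _ (half_pos hd)
    linarith
  have h5 : d / 2 * (-(2 * ψ x₁ / d)) = - ψ x₁ := by field_simp
  linarith

/-! ### Monotonicity of `x^A q₀(x)` from the second-order condition on `q₀`. -/

section LogDeriv

variable {q₀ : ℝ → ℝ} {ρ : ℝ}

/-- Where `q₀'` vanishes the quotient takes the default value `0`, away from its limit `1 + ρ ≥ 1`.
-/
theorem eventually_deriv_ne_zero (hρ : 0 ≤ ρ)
    (hlim : Tendsto (fun x => q₀ x * deriv (deriv q₀) x / (deriv q₀ x) ^ 2) atTop (𝓝 (1 + ρ))) :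
    ∀ᶠ x in atTop, deriv q₀ x ≠ 0 := by
  filter_upwards [hlim.eventually (lt_mem_nhds (by linarith : (0 : ℝ) < 1 + ρ))] with x hx h0
  simp [h0] at hx

/-- By Darboux a derivative without zeros has constant sign, and a positive function increasing on a
half-line cannot tend to `0`. -/
theorem eventually_deriv_neg (hρ : 0 ≤ ρ) (hpos : ∀ x, 0 < q₀ x) (hd : Differentiable ℝ q₀)
    (hzero : Tendsto q₀ atTop (𝓝 0))
    (hlim : Tendsto (fun x => q₀ x * deriv (deriv q₀) x / (deriv q₀ x) ^ 2) atTop (𝓝 (1 + ρ))) :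
    ∀ᶠ x in atTop, deriv q₀ x < 0 := by
  obtain ⟨x₁, hx₁⟩ := eventually_atTop.1 (eventually_deriv_ne_zero hρ hlim)
  rcases hasDerivWithinAt_forall_lt_or_forall_gt_of_forall_ne (convex_Ici x₁)
    (fun x _ => (hd x).hasDerivAt.hasDerivWithinAt) hx₁ with h1 | h1
  · exact eventually_atTop.2 ⟨x₁, h1⟩
  · exfalso
    have hmono : MonotoneOn q₀ (Ici x₁) :=
      monotoneOn_of_deriv_nonneg (convex_Ici x₁) hd.continuous.continuousOn
        hd.differentiableOn (fun x hx => (h1 x (interior_subset hx)).le)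
    have h2 : q₀ x₁ ≤ 0 := by
      refine ge_of_tendsto hzero ?_
      filter_upwards [eventually_ge_atTop x₁] with x hx
      exact hmono self_mem_Ici hx hx
    exact absurd (hpos x₁) (not_lt.2 h2)

theorem eventually_hasDerivAt_div_deriv (hρ : 0 ≤ ρ) (hd : Differentiable ℝ q₀)
    (hd2 : Differentiable ℝ (deriv q₀))
    (hlim : Tendsto (fun x => q₀ x * deriv (deriv q₀) x / (deriv q₀ x) ^ 2) atTop (𝓝 (1 + ρ))) :
    ∀ᶠ x in atTop, HasDerivAt (fun x => q₀ x / deriv q₀ x)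
      (1 - q₀ x * deriv (deriv q₀) x / (deriv q₀ x) ^ 2) x := by
  filter_upwards [eventually_deriv_ne_zero hρ hlim] with x hx
  refine ((hd x).hasDerivAt.div (hd2 x).hasDerivAt hx).congr_deriv ?_
  field_simp

/-- The derivative of `q₀ / q₀'` tends to `-ρ`, so `q₀ / q₀' + x / A` has slope tending to `1 / A -
ρ > 0` and is eventually positive; multiply by `q₀' < 0`. The resulting expression carries the sign
of the derivative of `x^A q₀`. -/
theorem eventually_add_mul_deriv_neg {A : ℝ} (hA : 0 < A) (hAρ : ρ < 1 / A) (hρ : 0 ≤ ρ)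
    (hpos : ∀ x, 0 < q₀ x) (hd : Differentiable ℝ q₀) (hd2 : Differentiable ℝ (deriv q₀))
    (hzero : Tendsto q₀ atTop (𝓝 0))
    (hlim : Tendsto (fun x => q₀ x * deriv (deriv q₀) x / (deriv q₀ x) ^ 2) atTop (𝓝 (1 + ρ))) :
    ∀ᶠ x in atTop, A * q₀ x + x * deriv q₀ x < 0 := by
  have h1 : ∀ᶠ x in atTop, 0 < q₀ x / deriv q₀ x + 1 / A * x := by
    refine eventually_pos_of_tendsto_deriv (d := 1 / A - ρ)
      (ψ' := fun x => (1 - q₀ x * deriv (deriv q₀) x / (deriv q₀ x) ^ 2) + 1 / A)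
      (by linarith) ?_ ?_
    · filter_upwards [eventually_hasDerivAt_div_deriv hρ hd hd2 hlim] with x hx
      exact (hx.add ((hasDerivAt_id x).const_mul (1 / A))).congr_deriv (by ring)
    · convert (hlim.const_sub 1).add_const (1 / A) using 2
      ring
  filter_upwards [h1, eventually_deriv_neg hρ hpos hd hzero hlim] with x h1 h2
  have h3 := mul_neg_of_neg_of_pos h2 h1
  have h4 : deriv q₀ x * (q₀ x / deriv q₀ x + 1 / A * x) = (A * q₀ x + x * deriv q₀ x) / A := by
    field_simp [h2.ne]
  rw [h4, div_lt_iff₀ hA] at h3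
  linarith

theorem eventually_add_mul_deriv_pos {B : ℝ} (hB : 0 < B) (hBρ : 1 / B < ρ) (hρ : 0 ≤ ρ)
    (hpos : ∀ x, 0 < q₀ x) (hd : Differentiable ℝ q₀) (hd2 : Differentiable ℝ (deriv q₀))
    (hzero : Tendsto q₀ atTop (𝓝 0))
    (hlim : Tendsto (fun x => q₀ x * deriv (deriv q₀) x / (deriv q₀ x) ^ 2) atTop (𝓝 (1 + ρ))) :
    ∀ᶠ x in atTop, 0 < B * q₀ x + x * deriv q₀ x := by
  have h1 : ∀ᶠ x in atTop, 0 < -(q₀ x / deriv q₀ x) + -(1 / B) * x := by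
    refine eventually_pos_of_tendsto_deriv (d := ρ - 1 / B)
      (ψ' := fun x => -(1 - q₀ x * deriv (deriv q₀) x / (deriv q₀ x) ^ 2) + -(1 / B))
      (by linarith) ?_ ?_
    · filter_upwards [eventually_hasDerivAt_div_deriv hρ hd hd2 hlim] with x hx
      exact (hx.neg.add ((hasDerivAt_id x).const_mul (-(1 / B)))).congr_deriv (by ring)
    · convert (hlim.const_sub 1).neg.add_const (-(1 / B)) using 2
      ring
  filter_upwards [h1, eventually_deriv_neg hρ hpos hd hzero hlim] with x h1 h2
  have h3 := mul_neg_of_neg_of_pos h2 h1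
  have h4 : deriv q₀ x * (-(q₀ x / deriv q₀ x) + -(1 / B) * x) =
      -((B * q₀ x + x * deriv q₀ x) / B) := by
    field_simp [h2.ne]
    ring
  rw [h4, neg_lt_zero] at h3
  exact (div_pos_iff_of_pos_right hB).1 h3

theorem hasDerivAt_rpow_mul {x : ℝ} (A : ℝ) (hx : 0 < x) (hd : Differentiable ℝ q₀) :
    HasDerivAt (fun x => x ^ A * q₀ x) (x ^ (A - 1) * (A * q₀ x + x * deriv q₀ x)) x := by
  refine ((Real.hasDerivAt_rpow_const (p := A) (Or.inl hx.ne')).mul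
    (hd x).hasDerivAt).congr_deriv ?_
  rw [Real.rpow_sub_one hx.ne']
  field_simp

theorem exists_antitoneOn_rpow_mul {A : ℝ} (hd : Differentiable ℝ q₀)
    (h1 : ∀ᶠ x in atTop, A * q₀ x + x * deriv q₀ x < 0) :
    ∃ x₁ > 0, AntitoneOn (fun x => x ^ A * q₀ x) (Ici x₁) := by
  obtain ⟨x₁, hx₁⟩ := eventually_atTop.1 (h1.and (eventually_gt_atTop 0))
  refine ⟨x₁, (hx₁ x₁ le_rfl).2, antitoneOn_of_deriv_nonpos (convex_Ici x₁) ?_ ?_ ?_⟩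
  · exact fun x hx => (hasDerivAt_rpow_mul A (hx₁ x hx).2 hd).continuousAt.continuousWithinAt
  · exact fun x hx => (hasDerivAt_rpow_mul A (hx₁ x (interior_subset hx)).2
      hd).differentiableAt.differentiableWithinAt
  · intro x hx
    have h2 := hx₁ x (interior_subset hx)
    rw [(hasDerivAt_rpow_mul A h2.2 hd).deriv]
    exact mul_nonpos_of_nonneg_of_nonpos (Real.rpow_nonneg h2.2.le _) h2.1.le

theorem exists_monotoneOn_rpow_mul {B : ℝ} (hd : Differentiable ℝ q₀)
    (h1 : ∀ᶠ x in atTop, 0 < B * q₀ x + x * deriv q₀ x) :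
    ∃ x₁ > 0, MonotoneOn (fun x => x ^ B * q₀ x) (Ici x₁) := by
  obtain ⟨x₁, hx₁⟩ := eventually_atTop.1 (h1.and (eventually_gt_atTop 0))
  refine ⟨x₁, (hx₁ x₁ le_rfl).2, monotoneOn_of_deriv_nonneg (convex_Ici x₁) ?_ ?_ ?_⟩
  · exact fun x hx => (hasDerivAt_rpow_mul B (hx₁ x hx).2 hd).continuousAt.continuousWithinAt
  · exact fun x hx => (hasDerivAt_rpow_mul B (hx₁ x (interior_subset hx)).2
      hd).differentiableAt.differentiableWithinAt
  · intro x hx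
    have h2 := hx₁ x (interior_subset hx)
    rw [(hasDerivAt_rpow_mul B h2.2 hd).deriv]
    exact mul_nonneg (Real.rpow_nonneg h2.2.le _) h2.1.le

end LogDeriv

/-! ### Potter bounds and regular variation of `q`. -/

section Potter

variable {q : ℝ → ℝ} {r : ℝ≥0∞}

theorem tendsto_zero_of_div_tendsto_one {q₀ : ℝ → ℝ} (hpos : ∀ x, 0 < q₀ x)
    (hq : Tendsto q atTop (𝓝 0)) (hdiv : Tendsto (fun x => q x / q₀ x) atTop (𝓝 1)) :
    Tendsto q₀ atTop (𝓝 0) := by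
  have h1 := hq.div hdiv one_ne_zero
  rw [zero_div] at h1
  refine h1.congr' ?_
  filter_upwards [hdiv.eventually (lt_mem_nhds zero_lt_one)] with x hx
  have h2 := hpos x
  have h3 : q x ≠ 0 := by
    intro h0
    simp [h0] at hx
  simp only [Pi.div_apply]
  field_simp

theorem IsLike.eventually_pos (hl : IsLike q r) : ∀ᶠ x in atTop, 0 < q x := by
  obtain ⟨q₀, hpos, -, -, hdiv, -⟩ := hl
  filter_upwards [hdiv.eventually (lt_mem_nhds zero_lt_one)] with x hx
  exact (div_pos_iff_of_pos_right (hpos x)).1 hx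

theorem eventually_le_mul_and_le_mul {q₀ : ℝ → ℝ} (hpos : ∀ x, 0 < q₀ x)
    (hdiv : Tendsto (fun x => q x / q₀ x) atTop (𝓝 1)) {D : ℝ} (hD : 1 < D) :
    ∀ᶠ x in atTop, q x ≤ D * q₀ x ∧ q₀ x ≤ D * q x := by
  filter_upwards [hdiv.eventually (gt_mem_nhds hD),
    hdiv.eventually (lt_mem_nhds (inv_lt_one_of_one_lt₀ hD))] with x h1 h2
  have h3 := hpos x
  rw [div_lt_iff₀ h3] at h1
  rw [lt_div_iff₀ h3, inv_mul_lt_iff₀ (by linarith)] at h2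
  exact ⟨h1.le, h2.le⟩

/-- For `q₀` the bound holds with constant `1`, because `x^A q₀` is eventually antitone; exchanging
`q` and `q₀` costs a factor `√C` at each end. -/
theorem IsLike.potter_upper (hl : IsLike q r) (hq : Tendsto q atTop (𝓝 0)) {A C : ℝ}
    (hA : 0 < A) (hAr : ENNReal.ofReal A < r) (hC : 1 < C) :
    ∀ᶠ x in atTop, ∀ s, 1 ≤ s → q (x * s) ≤ C * s ^ (-A) * q x := by
  obtain ⟨q₀, hpos, hd, hd2, hdiv, hlim⟩ := hl
  have hzero := tendsto_zero_of_div_tendsto_one hpos hq hdiv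
  have hAρ : (r⁻¹).toReal < 1 / A := by
    have h1 : r⁻¹ < (ENNReal.ofReal A)⁻¹ := ENNReal.inv_lt_inv.2 hAr
    rw [← ENNReal.ofReal_inv_of_pos hA] at h1
    rw [one_div]
    exact (ENNReal.lt_ofReal_iff_toReal_lt (ne_top_of_lt h1)).1 h1
  obtain ⟨x₁, hx₁, hanti⟩ := exists_antitoneOn_rpow_mul hd
    (eventually_add_mul_deriv_neg hA hAρ ENNReal.toReal_nonneg hpos hd hd2 hzero hlim)
  have hD : 1 < √C := (Real.lt_sqrt zero_le_one).2 (by linarith)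
  obtain ⟨x₂, hx₂⟩ := eventually_atTop.1 (eventually_le_mul_and_le_mul hpos hdiv hD)
  filter_upwards [eventually_ge_atTop x₁, eventually_ge_atTop x₂] with x h1 h2 s hs
  have hx : 0 < x := hx₁.trans_le h1
  have hxs : x ≤ x * s := le_mul_of_one_le_right hx.le hs
  have hs0 : 0 < s := by linarith
  have h3 : (x * s) ^ A * q₀ (x * s) ≤ x ^ A * q₀ x := hanti h1 (h1.trans hxs) hxs
  rw [Real.mul_rpow hx.le hs0.le, mul_assoc] at h3
  have h4 : s ^ A * q₀ (x * s) ≤ q₀ x := le_of_mul_le_mul_left h3 (Real.rpow_pos_of_pos hx A)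
  have h5 : q₀ (x * s) ≤ s ^ (-A) * q₀ x := by
    rw [Real.rpow_neg hs0.le]
    exact (le_inv_mul_iff₀ (Real.rpow_pos_of_pos hs0 A)).2 h4
  calc q (x * s) ≤ √C * q₀ (x * s) := (hx₂ _ (h2.trans hxs)).1
    _ ≤ √C * (s ^ (-A) * q₀ x) := by gcongr
    _ ≤ √C * (s ^ (-A) * (√C * q x)) := by
        gcongr
        exact (hx₂ x h2).2
    _ = (√C * √C) * s ^ (-A) * q x := by ring
    _ = C * s ^ (-A) * q x := by rw [Real.mul_self_sqrt (by linarith)]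

theorem IsLike.potter_lower (hl : IsLike q r) (hq : Tendsto q atTop (𝓝 0)) {B C : ℝ}
    (hB : 0 < B) (hr : r ≠ 0) (hBr : r < ENNReal.ofReal B) (hC : 1 < C) :
    ∀ᶠ x in atTop, ∀ s, 1 ≤ s → q x ≤ C * s ^ B * q (x * s) := by
  obtain ⟨q₀, hpos, hd, hd2, hdiv, hlim⟩ := hl
  have hzero := tendsto_zero_of_div_tendsto_one hpos hq hdiv
  have hBρ : 1 / B < (r⁻¹).toReal := by
    have h1 : (ENNReal.ofReal B)⁻¹ < r⁻¹ := ENNReal.inv_lt_inv.2 hBr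
    rw [← ENNReal.ofReal_inv_of_pos hB] at h1
    rw [one_div]
    exact (ENNReal.ofReal_lt_iff_lt_toReal (inv_pos.2 hB).le (by simpa using hr)).1 h1
  obtain ⟨x₁, hx₁, hmono⟩ := exists_monotoneOn_rpow_mul hd
    (eventually_add_mul_deriv_pos hB hBρ ENNReal.toReal_nonneg hpos hd hd2 hzero hlim)
  have hD : 1 < √C := (Real.lt_sqrt zero_le_one).2 (by linarith)
  obtain ⟨x₂, hx₂⟩ := eventually_atTop.1 (eventually_le_mul_and_le_mul hpos hdiv hD)
  filter_upwards [eventually_ge_atTop x₁, eventually_ge_atTop x₂] with x h1 h2 s hs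
  have hx : 0 < x := hx₁.trans_le h1
  have hxs : x ≤ x * s := le_mul_of_one_le_right hx.le hs
  have hs0 : 0 < s := by linarith
  have h3 : x ^ B * q₀ x ≤ (x * s) ^ B * q₀ (x * s) := hmono h1 (h1.trans hxs) hxs
  rw [Real.mul_rpow hx.le hs0.le, mul_assoc] at h3
  have h4 : q₀ x ≤ s ^ B * q₀ (x * s) := le_of_mul_le_mul_left h3 (Real.rpow_pos_of_pos hx B)
  calc q x ≤ √C * q₀ x := (hx₂ _ h2).1
    _ ≤ √C * (s ^ B * q₀ (x * s)) := by gcongr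
    _ ≤ √C * (s ^ B * (√C * q (x * s))) := by
        gcongr
        exact (hx₂ _ (h2.trans hxs)).2
    _ = (√C * √C) * s ^ B * q (x * s) := by ring
    _ = C * s ^ B * q (x * s) := by rw [Real.mul_self_sqrt (by linarith)]

theorem IsLike.tendsto_div_top (hl : IsLike q ⊤) (hq : Tendsto q atTop (𝓝 0))
    (hq0 : ∀ x, 0 ≤ q x) {s : ℝ} (hs : 1 < s) :
    Tendsto (fun x => q (x * s) / q x) atTop (𝓝 0) := by
  refine tendsto_order.2 ⟨fun a ha => Eventually.of_forall fun x =>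
    ha.trans_le (div_nonneg (hq0 _) (hq0 _)), fun a ha => ?_⟩
  have h1 : Tendsto (fun A : ℝ => 2 * s ^ (-A)) atTop (𝓝 0) := by
    simpa using ((tendsto_rpow_atBot_of_base_gt_one s hs).comp
      tendsto_neg_atTop_atBot).const_mul 2
  obtain ⟨A, hA1, hA2⟩ := ((h1.eventually (gt_mem_nhds ha)).and (eventually_gt_atTop 0)).exists
  filter_upwards [hl.potter_upper hq hA2 ENNReal.ofReal_lt_top one_lt_two, hl.eventually_pos]
    with x h2 h3
  rw [div_lt_iff₀ h3]
  exact (h2 s hs.le).trans_lt (mul_lt_mul_of_pos_right hA1 h3)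

theorem IsLike.tendsto_div_of_one_le {r : ℝ} (hr : 0 < r) (hl : IsLike q (ENNReal.ofReal r))
    (hq : Tendsto q atTop (𝓝 0)) {s : ℝ} (hs : 1 ≤ s) :
    Tendsto (fun x => q (x * s) / q x) atTop (𝓝 (s ^ (-r))) := by
  have hs0 : 0 < s := by linarith
  have hcont : Continuous fun A : ℝ => s ^ (-A) :=
    (Real.continuous_const_rpow hs0.ne').comp continuous_neg
  -- Squeeze between Potter bounds with exponents `r ± δ` and constant `1 + δ`, letting `δ ↓ 0`.
  refine tendsto_order.2 ⟨fun a ha => ?_, fun a ha => ?_⟩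
  · have h1 : Tendsto (fun δ : ℝ => (1 + δ)⁻¹ * s ^ (-(r + δ))) (𝓝[>] 0) (𝓝 (s ^ (-r))) := by
      refine Tendsto.mono_left ?_ nhdsWithin_le_nhds
      have : ContinuousAt (fun δ : ℝ => (1 + δ)⁻¹ * s ^ (-(r + δ))) 0 :=
        ContinuousAt.mul (ContinuousAt.inv₀ (by fun_prop) (by norm_num))
          (hcont.comp (by fun_prop : Continuous fun δ : ℝ => r + δ)).continuousAt
      simpa [ContinuousAt] using this
    obtain ⟨δ, hδ1, hδ2⟩ := ((h1.eventually (lt_mem_nhds ha)).and self_mem_nhdsWithin).exists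
    have hδ : 0 < δ := hδ2
    filter_upwards [hl.potter_lower hq (B := r + δ) (C := 1 + δ) (by linarith)
      (by simpa using hr) ((ENNReal.ofReal_lt_ofReal_iff (by linarith)).2 (by linarith))
      (by linarith), hl.eventually_pos] with x h2 h3
    refine hδ1.trans_le ?_
    rw [le_div_iff₀ h3, Real.rpow_neg hs0.le, ← mul_inv,
      inv_mul_le_iff₀ (mul_pos (by linarith) (Real.rpow_pos_of_pos hs0 _))]
    exact h2 s hs
  · have h1 : Tendsto (fun δ : ℝ => (1 + δ) * s ^ (-(r - δ))) (𝓝[>] 0) (𝓝 (s ^ (-r))) := by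
      refine Tendsto.mono_left ?_ nhdsWithin_le_nhds
      have : Continuous (fun δ : ℝ => (1 + δ) * s ^ (-(r - δ))) :=
        Continuous.mul (by fun_prop)
          (hcont.comp (by fun_prop : Continuous fun δ : ℝ => r - δ))
      simpa using this.tendsto 0
    obtain ⟨δ, ⟨hδ1, hδ2⟩, hδ3⟩ := (((h1.eventually (gt_mem_nhds ha)).and
      self_mem_nhdsWithin).and (nhdsWithin_le_nhds (gt_mem_nhds hr))).exists
    have hδ : 0 < δ := hδ2
    have hδ' : δ < r := hδ3
    filter_upwards [hl.potter_upper hq (A := r - δ) (C := 1 + δ) (by linarith)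
      ((ENNReal.ofReal_lt_ofReal_iff hr).2 (by linarith))
      (by linarith), hl.eventually_pos] with x h2 h3
    rw [div_lt_iff₀ h3]
    exact (h2 s hs).trans_lt (mul_lt_mul_of_pos_right hδ1 h3)

theorem IsLike.tendsto_div {r : ℝ} (hr : 0 < r) (hl : IsLike q (ENNReal.ofReal r))
    (hq : Tendsto q atTop (𝓝 0)) {s : ℝ} (hs : 0 < s) :
    Tendsto (fun x => q (x * s) / q x) atTop (𝓝 (s ^ (-r))) := by
  rcases le_total 1 s with h1 | h1
  · exact hl.tendsto_div_of_one_le hr hq h1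
  -- For `s ≤ 1`, use the factor `1/s ≥ 1` from the base point `xs` and invert.
  · have h2 := (hl.tendsto_div_of_one_le hr hq ((one_le_inv₀ hs).2 h1)).comp
      (tendsto_id.atTop_mul_const hs)
    have h3 := h2.inv₀ (Real.rpow_pos_of_pos (inv_pos.2 hs) _).ne'
    rw [Real.inv_rpow hs.le, inv_inv] at h3
    refine h3.congr fun x => ?_
    simp [hs.ne']

end Potter

end QuantileBounds

/-! ### Truncated moments compared with the tail. -/

namespace QuantileBounds

theorem lintegral_rpow_mul_exp_neg_mul_Ioi {b u : ℝ} (hb : 0 < b) (hu : 0 < u) :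
    ∫⁻ t in Ioi (0 : ℝ), ENNReal.ofReal (t ^ (b - 1) * Real.exp (-(u * t))) =
      ENNReal.ofReal (u ^ (-b) * Real.Gamma b) := by
  have key := Real.integral_rpow_mul_exp_neg_mul_Ioi hb hu
  have hG := Real.Gamma_pos_of_pos hb
  have hint : IntegrableOn (fun t : ℝ => t ^ (b - 1) * Real.exp (-(u * t))) (Ioi 0) :=
    .of_integral_ne_zero (by rw [key]; positivity)
  rw [← ofReal_integral_eq_lintegral_ofReal hint, key, one_div, Real.inv_rpow hu.le,
    Real.rpow_neg hu.le]
  filter_upwards [ae_restrict_mem measurableSet_Ioi] with t ht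
  have : (0 : ℝ) < t := ht
  positivity

/-- A Beta integral: write `Γ(r)(1 + s)^(-r)` as `∫ t^(r-1) e^(-(1+s)t) dt` and apply Tonelli; the
`s`-integral is `Γ(a) t^(-a)`, leaving `Γ(r - a)`. -/
theorem lintegral_one_add_rpow_mul_rpow {a r : ℝ} (ha : 0 < a) (har : a < r) :
    ∫⁻ s in Ioi (0 : ℝ), ENNReal.ofReal ((1 + s) ^ (-r)) * ENNReal.ofReal (s ^ (a - 1)) =
      ENNReal.ofReal (Real.Gamma a * Real.Gamma (r - a) / Real.Gamma r) := by
  have hr : 0 < r := ha.trans har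
  have hG := Real.Gamma_pos_of_pos hr
  have h1 : ENNReal.ofReal (Real.Gamma r) * ∫⁻ s in Ioi (0 : ℝ),
      ENNReal.ofReal ((1 + s) ^ (-r)) * ENNReal.ofReal (s ^ (a - 1)) =
      ENNReal.ofReal (Real.Gamma a * Real.Gamma (r - a)) := by
    calc ENNReal.ofReal (Real.Gamma r) * ∫⁻ s in Ioi (0 : ℝ),
          ENNReal.ofReal ((1 + s) ^ (-r)) * ENNReal.ofReal (s ^ (a - 1))
        = ∫⁻ s in Ioi (0 : ℝ), ∫⁻ t in Ioi (0 : ℝ), ENNReal.ofReal (s ^ (a - 1)) *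
            ENNReal.ofReal (t ^ (r - 1) * Real.exp (-((1 + s) * t))) := by
          rw [← lintegral_const_mul _ (by fun_prop)]
          refine setLIntegral_congr_fun measurableSet_Ioi fun s hs => ?_
          have hs0 : (0 : ℝ) < s := hs
          rw [lintegral_const_mul _ (by fun_prop),
            lintegral_rpow_mul_exp_neg_mul_Ioi hr (by linarith),
            ENNReal.ofReal_mul (by positivity)]
          ring
      _ = ∫⁻ t in Ioi (0 : ℝ), ∫⁻ s in Ioi (0 : ℝ), ENNReal.ofReal (s ^ (a - 1)) *
            ENNReal.ofReal (t ^ (r - 1) * Real.exp (-((1 + s) * t))) :=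
          lintegral_lintegral_swap (by fun_prop)
      _ = ∫⁻ t in Ioi (0 : ℝ), ENNReal.ofReal (Real.Gamma a) *
            ENNReal.ofReal (t ^ (r - a - 1) * Real.exp (-(1 * t))) := by
          refine setLIntegral_congr_fun measurableSet_Ioi fun t ht => ?_
          have ht0 : (0 : ℝ) < t := ht
          have h2 : ∀ s ∈ Ioi (0 : ℝ), ENNReal.ofReal (s ^ (a - 1)) *
              ENNReal.ofReal (t ^ (r - 1) * Real.exp (-((1 + s) * t))) =
              ENNReal.ofReal (t ^ (r - 1) * Real.exp (-(1 * t))) *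
                ENNReal.ofReal (s ^ (a - 1) * Real.exp (-(t * s))) := by
            intro s hs
            have hs0 : (0 : ℝ) < s := hs
            rw [← ENNReal.ofReal_mul (by positivity), ← ENNReal.ofReal_mul (by positivity),
              show -((1 + s) * t) = -(1 * t) + -(t * s) by ring, Real.exp_add]
            congr 1
            ring
          rw [setLIntegral_congr_fun measurableSet_Ioi h2, lintegral_const_mul _ (by fun_prop),
            lintegral_rpow_mul_exp_neg_mul_Ioi ha ht0, ← ENNReal.ofReal_mul (by positivity),
            ← ENNReal.ofReal_mul (Real.Gamma_pos_of_pos ha).le,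
            show r - a - 1 = (r - 1) + (-a) by ring, Real.rpow_add ht0]
          congr 1
          ring
      _ = ENNReal.ofReal (Real.Gamma a * Real.Gamma (r - a)) := by
          rw [lintegral_const_mul _ (by fun_prop),
            lintegral_rpow_mul_exp_neg_mul_Ioi (sub_pos.2 har) one_pos, Real.one_rpow, one_mul,
            ENNReal.ofReal_mul (Real.Gamma_pos_of_pos ha).le]
  rw [ENNReal.ofReal_div_of_pos hG, ← h1,
    mul_comm, ENNReal.mul_div_cancel_right (by simpa using hG) ENNReal.ofReal_ne_top]

variable {Ω : Type*} [MeasurableSpace Ω]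

/-- The truncated moment `E (X / x - θ)_+ ^ a`. -/
noncomputable def tailMoment (μ : Measure Ω) (X : Ω → ℝ) (a θ x : ℝ) : ℝ≥0∞ :=
  ∫⁻ ω, ENNReal.ofReal ((max 0 (X ω / x - θ)) ^ a) ∂μ

variable {μ : Measure Ω} {X : Ω → ℝ} {a : ℝ}

theorem tailMoment_anti (ha : 0 < a) (x : ℝ) : Antitone fun θ => tailMoment μ X a θ x := by
  intro θ θ' h
  refine lintegral_mono fun ω => ENNReal.ofReal_le_ofReal ?_
  gcongr

theorem tailMoment_eq_mul {θ x : ℝ} (hθ : 0 < θ) :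
    tailMoment μ X a θ x = ENNReal.ofReal (θ ^ a) * tailMoment μ X a 1 (x * θ) := by
  unfold tailMoment
  rw [← lintegral_const_mul' _ _ ENNReal.ofReal_ne_top]
  refine lintegral_congr fun ω => ?_
  rw [← ENNReal.ofReal_mul (by positivity), ← Real.mul_rpow hθ.le (le_max_left _ _),
    mul_max_of_nonneg _ _ hθ.le]
  congr 3
  · simp
  · field_simp

theorem tailMoment_one_eq_lintegral (hX : Measurable X) (ha : 0 < a) {y : ℝ} (hy : 0 < y) :
    tailMoment μ X a 1 y = ENNReal.ofReal a *
      ∫⁻ s in Ioi (0 : ℝ), μ {ω | y * (1 + s) ≤ X ω} * ENNReal.ofReal (s ^ (a - 1)) := by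
  unfold tailMoment
  rw [lintegral_rpow_eq_lintegral_meas_le_mul μ (f := fun ω => max 0 (X ω / y - 1))
    (Eventually.of_forall fun ω => le_max_left _ _) (by fun_prop) ha]
  congr 1
  refine setLIntegral_congr_fun measurableSet_Ioi fun s hs => ?_
  have hs0 : (0 : ℝ) < s := hs
  congr 2
  ext ω
  simp only [mem_ofPred_eq, le_max_iff, hs0.not_ge, false_or, le_sub_iff_add_le, le_div_iff₀ hy]
  rw [mul_comm, add_comm]

theorem antitone_measure_tail : Antitone fun x => μ {ω | x ≤ X ω} :=
  fun _ _ h => measure_mono fun _ hω => h.trans hω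

/-- Dominated convergence in the layer-cake formula; the majorant `2 (1 + s)^(-B) s^(a-1)` is
integrable because `a < B`. -/
theorem tendsto_tailMoment_div [IsProbabilityMeasure μ] (hX : Measurable X) (ha : 0 < a)
    {B : ℝ} (hB : a < B) {g : ℝ → ℝ}
    (hpos : ∀ᶠ y in atTop, 0 < μ.real {ω | y ≤ X ω})
    (hpot : ∀ᶠ y in atTop, ∀ s, 1 ≤ s →
      μ.real {ω | y * s ≤ X ω} ≤ 2 * s ^ (-B) * μ.real {ω | y ≤ X ω})
    (hlim : ∀ s, 0 < s → Tendsto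
      (fun y => μ.real {ω | y * (1 + s) ≤ X ω} / μ.real {ω | y ≤ X ω}) atTop (𝓝 (g s))) :
    Tendsto (fun y => tailMoment μ X a 1 y / ENNReal.ofReal (μ.real {ω | y ≤ X ω})) atTop
      (𝓝 (ENNReal.ofReal a *
        ∫⁻ s in Ioi (0 : ℝ), ENNReal.ofReal (g s) * ENNReal.ofReal (s ^ (a - 1)))) := by
  have hrat : ∀ y s : ℝ, 0 < μ.real {ω | y ≤ X ω} →
      μ {ω | y * (1 + s) ≤ X ω} * (ENNReal.ofReal (μ.real {ω | y ≤ X ω}))⁻¹ =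
      ENNReal.ofReal (μ.real {ω | y * (1 + s) ≤ X ω} / μ.real {ω | y ≤ X ω}) := by
    intro y s hy
    rw [ENNReal.ofReal_div_of_pos hy, ENNReal.div_eq_inv_mul, mul_comm, ofReal_measureReal,
      ofReal_measureReal, mul_comm]
  have key : Tendsto (fun y => ENNReal.ofReal a * ∫⁻ s in Ioi (0 : ℝ),
      μ {ω | y * (1 + s) ≤ X ω} * (ENNReal.ofReal (μ.real {ω | y ≤ X ω}))⁻¹ *
        ENNReal.ofReal (s ^ (a - 1))) atTop
      (𝓝 (ENNReal.ofReal a *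
        ∫⁻ s in Ioi (0 : ℝ), ENNReal.ofReal (g s) * ENNReal.ofReal (s ^ (a - 1)))) := by
    refine ENNReal.Tendsto.const_mul ?_ (Or.inr ENNReal.ofReal_ne_top)
    refine tendsto_lintegral_filter_of_dominated_convergence
      (fun s => ENNReal.ofReal 2 * (ENNReal.ofReal ((1 + s) ^ (-B)) *
        ENNReal.ofReal (s ^ (a - 1)))) ?_ ?_ ?_ ?_
    · filter_upwards [eventually_ge_atTop 0] with y hy
      refine Measurable.mul (Measurable.mul_const ?_ _) (by fun_prop)
      refine Antitone.measurable fun s t hst => antitone_measure_tail ?_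
      gcongr
    · filter_upwards [hpos, hpot] with y h1 h2
      filter_upwards [ae_restrict_mem measurableSet_Ioi] with s hs
      have hs0 : (0 : ℝ) < s := hs
      rw [hrat y s h1, ← mul_assoc, ← ENNReal.ofReal_mul zero_le_two]
      gcongr
      rw [div_le_iff₀ h1]
      exact h2 (1 + s) (by linarith)
    · rw [lintegral_const_mul _ (by fun_prop), lintegral_one_add_rpow_mul_rpow ha hB]
      exact ENNReal.mul_ne_top ENNReal.ofReal_ne_top ENNReal.ofReal_ne_top
    · filter_upwards [ae_restrict_mem measurableSet_Ioi] with s hs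
      have hs0 : (0 : ℝ) < s := hs
      refine ENNReal.Tendsto.mul_const ?_ (Or.inr ENNReal.ofReal_ne_top)
      refine (ENNReal.tendsto_ofReal (hlim s hs0)).congr' ?_
      filter_upwards [hpos] with y h1
      exact (hrat y s h1).symm
  refine key.congr' ?_
  filter_upwards [hpos, eventually_gt_atTop 0] with y h1 hy
  rw [tailMoment_one_eq_lintegral hX ha hy, mul_div_assoc, ENNReal.div_eq_inv_mul,
    ← lintegral_const_mul' _ (fun s => _ * _)
      (ENNReal.inv_ne_top.2 (ENNReal.ofReal_pos.2 h1).ne')]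
  congr 1
  refine lintegral_congr fun s => ?_
  ring

/-- The limit of `E (X / y - 1)_+ ^ a / P(X ≥ y)` for a tail that is like `x ^ (-r)`. -/
noncomputable def tailConst (a r : ℝ) : ℝ :=
  Real.Gamma (a + 1) * Real.Gamma (r - a) / Real.Gamma r

theorem tailConst_pos {a r : ℝ} (ha : 0 ≤ a) (har : a < r) : 0 < tailConst a r := by
  unfold tailConst
  have h1 := Real.Gamma_pos_of_pos (show 0 < a + 1 by linarith)
  have h2 := Real.Gamma_pos_of_pos (show 0 < r - a by linarith)
  have h3 := Real.Gamma_pos_of_pos (show 0 < r by linarith)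
  positivity

theorem eventually_tailMoment_le {C b : ℝ} (hpos : ∀ᶠ y in atTop, 0 < μ.real {ω | y ≤ X ω})
    (hlim : Tendsto (fun y => tailMoment μ X a 1 y / ENNReal.ofReal (μ.real {ω | y ≤ X ω})) atTop
      (𝓝 (ENNReal.ofReal C))) (hb : 0 < b) (hC : C < b) :
    ∀ᶠ y in atTop, tailMoment μ X a 1 y ≤ ENNReal.ofReal (b * μ.real {ω | y ≤ X ω}) := by
  filter_upwards [hpos, hlim.eventually (gt_mem_nhds
    ((ENNReal.ofReal_lt_ofReal_iff hb).2 hC))] with y h1 h2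
  rw [ENNReal.ofReal_mul hb.le]
  exact (ENNReal.div_le_iff_le_mul (Or.inl (ENNReal.ofReal_pos.2 h1).ne')
    (Or.inl ENNReal.ofReal_ne_top)).1 h2.le

theorem eventually_le_tailMoment {C b : ℝ} (hpos : ∀ᶠ y in atTop, 0 < μ.real {ω | y ≤ X ω})
    (hlim : Tendsto (fun y => tailMoment μ X a 1 y / ENNReal.ofReal (μ.real {ω | y ≤ X ω})) atTop
      (𝓝 (ENNReal.ofReal C))) (hb : 0 < b) (hC : b < C) :
    ∀ᶠ y in atTop, ENNReal.ofReal (b * μ.real {ω | y ≤ X ω}) ≤ tailMoment μ X a 1 y := by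
  filter_upwards [hpos, hlim.eventually (lt_mem_nhds
    ((ENNReal.ofReal_lt_ofReal_iff (hb.trans hC)).2 hC))] with y h1 h2
  rw [ENNReal.ofReal_mul hb.le]
  exact (ENNReal.le_div_iff_mul_le (Or.inl (ENNReal.ofReal_pos.2 h1).ne')
    (Or.inl ENNReal.ofReal_ne_top)).1 h2.le

variable [IsProbabilityMeasure μ]

theorem tendsto_measureReal_tail (hX : Measurable X) :
    Tendsto (fun x => μ.real {ω | x ≤ X ω}) atTop (𝓝 0) := by
  have h1 : Tendsto (fun x => μ {ω | x ≤ X ω}) atTop (𝓝 (μ (⋂ x : ℝ, {ω | x ≤ X ω}))) := by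
    refine tendsto_measure_iInter_atTop (fun x => (measurableSet_le measurable_const
      hX).nullMeasurableSet) (fun x y h ω hω => h.trans hω) ⟨0, measure_ne_top _ _⟩
  have h2 : (⋂ x : ℝ, {ω | x ≤ X ω}) = ∅ := by
    ext ω
    simp only [mem_iInter, mem_ofPred_eq, mem_empty_iff_false, iff_false, not_forall, not_le]
    exact ⟨X ω + 1, by linarith⟩
  rw [h2, measure_empty] at h1
  exact (ENNReal.tendsto_toReal ENNReal.zero_ne_top).comp h1

theorem tendsto_tailMoment_div_of_isLike (hX : Measurable X) (ha : 0 < a) {r : ℝ} (har : a < r)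
    (hl : IsLike (fun x => μ.real {ω | x ≤ X ω}) (ENNReal.ofReal r)) :
    Tendsto (fun y => tailMoment μ X a 1 y / ENNReal.ofReal (μ.real {ω | y ≤ X ω})) atTop
      (𝓝 (ENNReal.ofReal (tailConst a r))) := by
  -- `B > a` makes the majorant integrable, `B < r` makes the Potter bound available.
  obtain ⟨B, hB1, hB2⟩ := exists_between har
  have hr : 0 < r := ha.trans har
  have hq := tendsto_measureReal_tail (μ := μ) hX
  have h1 := tendsto_tailMoment_div hX ha hB1 hl.eventually_pos
    (hl.potter_upper hq (ha.trans hB1) ((ENNReal.ofReal_lt_ofReal_iff hr).2 hB2) one_lt_two)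
    (fun s hs => hl.tendsto_div hr hq (by linarith : 0 < 1 + s))
  rw [lintegral_one_add_rpow_mul_rpow ha har, ← ENNReal.ofReal_mul ha.le] at h1
  convert h1 using 3
  unfold tailConst
  rw [Real.Gamma_add_one ha.ne']
  ring

theorem tendsto_tailMoment_div_of_isLike_top (hX : Measurable X) (ha : 0 < a)
    (hl : IsLike (fun x => μ.real {ω | x ≤ X ω}) ⊤) :
    Tendsto (fun y => tailMoment μ X a 1 y / ENNReal.ofReal (μ.real {ω | y ≤ X ω})) atTop
      (𝓝 0) := by
  have hq := tendsto_measureReal_tail (μ := μ) hX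
  have h1 := tendsto_tailMoment_div hX ha (lt_add_one a) (g := fun _ => 0) hl.eventually_pos
    (hl.potter_upper hq (by linarith) ENNReal.ofReal_lt_top one_lt_two)
    (fun s hs => hl.tendsto_div_top hq (fun _ => measureReal_nonneg) (by linarith : 1 < 1 + s))
  simpa using h1

end QuantileBounds

/-! ### Optimization over `θ`, and comparison of `P_α(X; κz)` with the tail at `z`. -/

namespace QuantileBounds

section Constants

variable {a r : ℝ}

theorem c_eq_tailConst_mul : c r a = tailConst a r * (r ^ r / (a ^ a * (r - a) ^ (r - a))) := rfl

theorem c_pos (ha : 0 ≤ a) (har : a < r) : 0 < c r a := by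
  rw [c_eq_tailConst_mul]
  have h1 := tailConst_pos ha har
  have h2 : 0 < r := ha.trans_lt har
  have h3 : 0 < r - a := sub_pos.2 har
  have h4 : 0 < a ^ a := by
    rcases ha.eq_or_lt with rfl | ha'
    · simp
    · positivity
  positivity

theorem c_zero_right (hr : 0 < r) : c r 0 = 1 := by
  have h1 := Real.Gamma_pos_of_pos hr
  have h2 : 0 < r ^ r := by positivity
  simp [c, h1.ne', h2.ne']

theorem c_eq_tailConst_mul_optimal (ha : 0 < a) (har : a < r) :
    tailConst a r * ((1 - (r - a) / r) ^ (-a) * ((r - a) / r) ^ (a - r)) = c r a := by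
  have hr : 0 < r := ha.trans har
  have h3 : 0 < r - a := sub_pos.2 har
  rw [c_eq_tailConst_mul, show 1 - (r - a) / r = a / r by field_simp; ring,
    Real.div_rpow ha.le hr.le, Real.div_rpow h3.le hr.le, show a - r = -(r - a) by ring,
    Real.rpow_neg ha.le, Real.rpow_neg hr.le, Real.rpow_neg hr.le, Real.rpow_neg h3.le]
  have h4 : r ^ r = r ^ a * r ^ (r - a) := by rw [← Real.rpow_add hr]; congr 1; ring
  rw [h4]
  have := Real.rpow_pos_of_pos hr a
  have := Real.rpow_pos_of_pos hr (r - a)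
  field_simp

/-- Weighted AM-GM with weights `(r - a)/r` and `a/r`, scaled so that both terms equal `1` at the
maximizer `θ = (r - a)/r`. -/
theorem rpow_mul_rpow_le (ha : 0 < a) (har : a < r) {θ : ℝ} (h0 : 0 < θ) (h1 : θ ≤ 1) :
    θ ^ (r - a) * (1 - θ) ^ a * (r ^ r / (a ^ a * (r - a) ^ (r - a))) ≤ 1 := by
  have hr : 0 < r := ha.trans har
  have h3 : 0 < r - a := sub_pos.2 har
  have h4 : 0 ≤ 1 - θ := sub_nonneg.2 h1
  have h5 := Real.geom_mean_le_arith_mean2_weighted (w₁ := (r - a) / r) (w₂ := a / r)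
    (p₁ := θ * (r / (r - a))) (p₂ := (1 - θ) * (r / a)) (by positivity) (by positivity)
    (by positivity) (by positivity) (by field_simp; ring)
  have h6 : (r - a) / r * (θ * (r / (r - a))) + a / r * ((1 - θ) * (r / a)) = 1 := by
    field_simp
    ring
  rw [h6] at h5
  have h7 := Real.rpow_le_rpow (by positivity) h5 hr.le
  rw [Real.one_rpow, Real.mul_rpow (by positivity) (by positivity), ← Real.rpow_mul (by positivity),
    ← Real.rpow_mul (by positivity), div_mul_cancel₀ _ hr.ne', div_mul_cancel₀ _ hr.ne',
    Real.mul_rpow h0.le (by positivity), Real.mul_rpow h4 (by positivity),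
    Real.div_rpow hr.le h3.le, Real.div_rpow hr.le ha.le] at h7
  refine le_trans (le_of_eq ?_) h7
  have h8 : r ^ r = r ^ a * r ^ (r - a) := by rw [← Real.rpow_add hr]; congr 1; ring
  rw [h8]
  field_simp

/-- The right side is the limit of `tailMoment μ X a θ (κ * z) / q(z)`; this is the lower bound in
the limit, for each single `θ`. -/
theorem one_sub_rpow_lt (ha : 0 < a) (har : a < r) {κ : ℝ} (hκ : 0 < κ) (hκc : κ ^ r < c r a)
    {θ : ℝ} (h0 : 0 < θ) (h1 : θ ≤ 1) :
    (1 - θ) ^ a < θ ^ a * tailConst a r * (κ * θ) ^ (-r) := by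
  have hJ := tailConst_pos ha.le har
  have h2 := rpow_mul_rpow_le ha har h0 h1
  have h3 : θ ^ (r - a) * (1 - θ) ^ a * c r a ≤ tailConst a r := by
    rw [c_eq_tailConst_mul]
    calc _ = tailConst a r *
          (θ ^ (r - a) * (1 - θ) ^ a * (r ^ r / (a ^ a * (r - a) ^ (r - a)))) := by ring
      _ ≤ tailConst a r * 1 := by gcongr
      _ = _ := mul_one _
  have h4 : θ ^ a * tailConst a r * (κ * θ) ^ (-r) =
      tailConst a r / (θ ^ (r - a) * κ ^ r) := by
    have h5 : θ ^ r = θ ^ a * θ ^ (r - a) := by rw [← Real.rpow_add h0]; congr 1; ring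
    rw [Real.rpow_neg (by positivity), Real.mul_rpow hκ.le h0.le, h5]
    have := Real.rpow_pos_of_pos h0 a
    field_simp
  have h6 := Real.rpow_pos_of_pos h0 (r - a)
  rw [h4, lt_div_iff₀ (by positivity)]
  rcases h1.eq_or_lt with rfl | h1'
  · simpa [ha.ne'] using hJ
  · have h7 : 0 < (1 - θ) ^ a := Real.rpow_pos_of_pos (sub_pos.2 h1') a
    calc (1 - θ) ^ a * (θ ^ (r - a) * κ ^ r) = θ ^ (r - a) * (1 - θ) ^ a * κ ^ r := by ring
      _ < θ ^ (r - a) * (1 - θ) ^ a * c r a := by gcongr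
      _ ≤ _ := h3

end Constants

variable {Ω : Type*} [MeasurableSpace Ω] {μ : Measure Ω} {X : Ω → ℝ} {α : ℝ≥0∞}

/-- With this `l`, `1 + l (X - x)/α = (X/x - θ)/(1 - θ)`. As `l` runs over `(0, ∞)`, `θ` runs over
all of `(-∞, 1)`, negative values included. -/
theorem A_eq_tailMoment (h0 : α ≠ 0) (htop : α ≠ ⊤) {x θ : ℝ} (hx : 0 < x) (hθ : θ < 1) :
    A μ X α x (α.toReal / (x * (1 - θ))) =
      ENNReal.ofReal ((1 - θ) ^ (-α.toReal)) * tailMoment μ X α.toReal θ x := by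
  have ha : 0 < α.toReal := ENNReal.toReal_pos h0 htop
  have h1 : 0 < 1 - θ := sub_pos.2 hθ
  unfold A tailMoment
  rw [← lintegral_const_mul' _ _ ENNReal.ofReal_ne_top]
  refine lintegral_congr fun ω => ?_
  rw [← ENNReal.ofReal_mul (by positivity), Real.rpow_neg h1.le, ← Real.inv_rpow h1.le,
    ← Real.mul_rpow (by positivity) (le_max_left _ _), mul_max_of_nonneg _ _ (by positivity),
    mul_zero]
  simp only [h, h0, htop, if_false]
  congr 3
  field_simp
  ring

theorem P_le_tailMoment (h0 : α ≠ 0) (htop : α ≠ ⊤) {x θ : ℝ} (hx : 0 < x) (hθ : θ < 1) :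
    P μ X α x ≤ ENNReal.ofReal ((1 - θ) ^ (-α.toReal)) * tailMoment μ X α.toReal θ x := by
  rw [← A_eq_tailMoment h0 htop hx hθ]
  exact iInf₂_le _ (div_pos (ENNReal.toReal_pos h0 htop) (mul_pos hx (sub_pos.2 hθ)))

theorem le_P_of_le_tailMoment (h0 : α ≠ 0) (htop : α ≠ ⊤) {x : ℝ} (hx : 0 < x) {b : ℝ}
    (hb : ∀ θ < 1, ENNReal.ofReal (b * (1 - θ) ^ α.toReal) ≤ tailMoment μ X α.toReal θ x) :
    ENNReal.ofReal b ≤ P μ X α x := by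
  have ha : 0 < α.toReal := ENNReal.toReal_pos h0 htop
  refine le_iInf₂ fun l hl => ?_
  have hl0 : 0 < l := hl
  have hθ : 1 - α.toReal / (l * x) < 1 := sub_lt_self _ (by positivity)
  have h1 : α.toReal / (x * (1 - (1 - α.toReal / (l * x)))) = l := by
    field_simp
    ring_nf
    field_simp
  have h2 := A_eq_tailMoment (μ := μ) (X := X) h0 htop hx hθ
  rw [h1] at h2
  rw [h2]
  have h3 : 0 < 1 - (1 - α.toReal / (l * x)) := sub_pos.2 hθ
  refine le_trans (le_of_eq ?_) (mul_le_mul_right (hb _ hθ) _)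
  rw [← ENNReal.ofReal_mul (by positivity), Real.rpow_neg h3.le]
  congr 1
  rw [mul_comm b, inv_mul_cancel_left₀ (Real.rpow_pos_of_pos h3 α.toReal).ne']

/-- Markov's inequality: on `X ≥ 2δx` one has `X/x - θ ≥ 2δ - θ ≥ δ(1 - θ)`. The bound is uniform
over the unbounded range `θ ≤ δ`. -/
theorem mul_measureReal_le_tailMoment [IsProbabilityMeasure μ] (hX : Measurable X) {a : ℝ}
    (ha : 0 < a) {x θ δ : ℝ} (hx : 0 < x) (hδ0 : 0 < δ) (hδ1 : δ ≤ 1) (hθ : θ ≤ δ) :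
    ENNReal.ofReal (δ ^ a * (1 - θ) ^ a * μ.real {ω | x * (2 * δ) ≤ X ω}) ≤
      tailMoment μ X a θ x := by
  have h1 : 0 ≤ 1 - θ := by linarith
  have h2 := mul_meas_ge_le_lintegral₀ (μ := μ)
    (f := fun ω => ENNReal.ofReal ((max 0 (X ω / x - θ)) ^ a)) (by fun_prop)
    (ENNReal.ofReal (δ ^ a * (1 - θ) ^ a))
  refine le_trans ?_ h2
  rw [ENNReal.ofReal_mul (by positivity), ofReal_measureReal]
  gcongr with ω
  intro hω
  refine ENNReal.ofReal_le_ofReal ?_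
  rw [← Real.mul_rpow hδ0.le h1]
  gcongr
  refine le_max_of_le_right ?_
  have h3 : 2 * δ ≤ X ω / x := by
    rw [le_div_iff₀ hx, mul_comm]
    exact hω
  nlinarith

variable [IsProbabilityMeasure μ]

theorem eventually_P_le (hX : Measurable X) (h0 : α ≠ 0) (htop : α ≠ ⊤) {r : ℝ}
    (har : α.toReal < r) (hl : IsLike (fun x => μ.real {ω | x ≤ X ω}) (ENNReal.ofReal r))
    {κ : ℝ} (hκ : 0 < κ) (hκc : c r α.toReal < κ ^ r) :
    ∀ᶠ z in atTop, P μ X α (κ * z) ≤ ENNReal.ofReal (μ.real {ω | z ≤ X ω}) := by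
  have ha : 0 < α.toReal := ENNReal.toReal_pos h0 htop
  set a := α.toReal
  have hr : 0 < r := ha.trans har
  have hJ := tailConst_pos ha.le har
  set θ := (r - a) / r with hθdef
  have hθ0 : 0 < θ := div_pos (sub_pos.2 har) hr
  have hθ1 : θ < 1 := (div_lt_one hr).2 (by linarith)
  have hθ2 : 0 < 1 - θ := sub_pos.2 hθ1
  have hlimδ : Tendsto (fun δ : ℝ => (1 - θ) ^ (-a) * θ ^ a * (tailConst a r + δ) *
      ((κ * θ) ^ (-r) + δ)) (𝓝[>] 0)
      (𝓝 ((1 - θ) ^ (-a) * θ ^ a * tailConst a r * (κ * θ) ^ (-r))) := by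
    refine Tendsto.mono_left ?_ nhdsWithin_le_nhds
    have : Continuous fun δ : ℝ => (1 - θ) ^ (-a) * θ ^ a * (tailConst a r + δ) *
      ((κ * θ) ^ (-r) + δ) := by fun_prop
    simpa using this.tendsto 0
  have hlt : (1 - θ) ^ (-a) * θ ^ a * tailConst a r * (κ * θ) ^ (-r) < 1 := by
    have h1 : (1 - θ) ^ (-a) * θ ^ a * tailConst a r * (κ * θ) ^ (-r) = c r a / κ ^ r := by
      rw [← c_eq_tailConst_mul_optimal ha har, ← hθdef, Real.mul_rpow hκ.le hθ0.le,
        show a - r = a + -r by ring, Real.rpow_add hθ0, Real.rpow_neg hκ.le]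
      field_simp
    rw [h1]
    exact (div_lt_one (by positivity)).2 hκc
  -- `δ` is the slack allowed in both limits, the moment ratio and the tail ratio, keeping the
  -- product below `1`.
  obtain ⟨δ, hδ1, hδ2⟩ := ((hlimδ.eventually (gt_mem_nhds hlt)).and self_mem_nhdsWithin).exists
  have hδ : 0 < δ := hδ2
  have hq := tendsto_measureReal_tail (μ := μ) hX
  have hκθ : 0 < κ * θ := mul_pos hκ hθ0
  have e1 := (tendsto_id.atTop_mul_const hκθ).eventually (eventually_tailMoment_le hl.eventually_pos
    (tendsto_tailMoment_div_of_isLike hX ha har hl) (b := tailConst a r + δ) (by linarith)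
    (by linarith))
  have e2 := (hl.tendsto_div hr hq hκθ).eventually (gt_mem_nhds (lt_add_of_pos_right _ hδ))
  filter_upwards [e1, e2, hl.eventually_pos, eventually_gt_atTop 0] with z h1 h2 h3 hz
  rw [div_lt_iff₀ h3] at h2
  have hz' : 0 < κ * z := mul_pos hκ hz
  refine (P_le_tailMoment h0 htop hz' hθ1).trans ?_
  rw [tailMoment_eq_mul hθ0, show κ * z * θ = z * (κ * θ) by ring]
  calc _ ≤ ENNReal.ofReal ((1 - θ) ^ (-a)) * (ENNReal.ofReal (θ ^ a) *
        ENNReal.ofReal ((tailConst a r + δ) * μ.real {ω | z * (κ * θ) ≤ X ω})) := by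
          gcongr
          exact h1
    _ = ENNReal.ofReal ((1 - θ) ^ (-a) * (θ ^ a *
        ((tailConst a r + δ) * μ.real {ω | z * (κ * θ) ≤ X ω}))) := by
          rw [← ENNReal.ofReal_mul (by positivity), ← ENNReal.ofReal_mul (by positivity)]
    _ ≤ ENNReal.ofReal ((1 - θ) ^ (-a) * (θ ^ a *
        ((tailConst a r + δ) * (((κ * θ) ^ (-r) + δ) * μ.real {ω | z ≤ X ω})))) := by
          gcongr
    _ = ENNReal.ofReal ((1 - θ) ^ (-a) * θ ^ a * (tailConst a r + δ) * ((κ * θ) ^ (-r) + δ) *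
          μ.real {ω | z ≤ X ω}) := by
          congr 1
          ring
    _ ≤ ENNReal.ofReal (1 * μ.real {ω | z ≤ X ω}) := by gcongr
    _ = _ := by rw [one_mul]

/-- The choice `θ = 1/κ` puts the truncation level `κzθ` at `z` itself, where the moment is
`o(q(z))`. -/
theorem eventually_P_le_top (hX : Measurable X) (h0 : α ≠ 0) (htop : α ≠ ⊤)
    (hl : IsLike (fun x => μ.real {ω | x ≤ X ω}) ⊤) {κ : ℝ} (hκ : 1 < κ) :
    ∀ᶠ z in atTop, P μ X α (κ * z) ≤ ENNReal.ofReal (μ.real {ω | z ≤ X ω}) := by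
  have ha : 0 < α.toReal := ENNReal.toReal_pos h0 htop
  set a := α.toReal
  have hκ0 : 0 < κ := by linarith
  have hθ0 : 0 < κ⁻¹ := inv_pos.2 hκ0
  have hθ1 : κ⁻¹ < 1 := inv_lt_one_of_one_lt₀ hκ
  have hθ2 : 0 < 1 - κ⁻¹ := sub_pos.2 hθ1
  have hb : 0 < (1 - κ⁻¹) ^ a * κ⁻¹ ^ (-a) := by positivity
  have hlim := tendsto_tailMoment_div_of_isLike_top hX ha hl
  rw [← ENNReal.ofReal_zero] at hlim
  filter_upwards [eventually_tailMoment_le hl.eventually_pos hlim hb hb, eventually_gt_atTop 0]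
    with z h1 hz
  have hz' : 0 < κ * z := mul_pos hκ0 hz
  refine (P_le_tailMoment h0 htop hz' hθ1).trans ?_
  rw [tailMoment_eq_mul hθ0, show κ * z * κ⁻¹ = z by field_simp]
  calc _ ≤ ENNReal.ofReal ((1 - κ⁻¹) ^ (-a)) * (ENNReal.ofReal (κ⁻¹ ^ a) *
        ENNReal.ofReal ((1 - κ⁻¹) ^ a * κ⁻¹ ^ (-a) * μ.real {ω | z ≤ X ω})) := by gcongr
    _ = _ := by
      rw [← ENNReal.ofReal_mul (by positivity), ← ENNReal.ofReal_mul (by positivity),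
        Real.rpow_neg hθ2.le, Real.rpow_neg hθ0.le]
      congr 1
      have h2 := Real.rpow_pos_of_pos hθ2 a
      have h3 := Real.rpow_pos_of_pos hθ0 a
      generalize (1 - κ⁻¹) ^ a = u at *
      generalize κ⁻¹ ^ a = v at *
      field_simp

/-- Local uniformity in `θ` comes from monotonicity: near `θ₀` the moment is bounded below by its
value at `θ₀ + δ`, and `(1 - θ)_+^a` above by its value at `θ₀ - δ`. The positive part matters at
`θ₀ = 1`, whose neighbourhoods pass `1`. -/
theorem exists_nhds_eventually_le_tailMoment (hX : Measurable X) {a r : ℝ} (ha : 0 < a)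
    (har : a < r) (hl : IsLike (fun x => μ.real {ω | x ≤ X ω}) (ENNReal.ofReal r))
    {κ : ℝ} (hκ : 0 < κ) (hκc : κ ^ r < c r a) {θ₀ : ℝ} (h0 : 0 < θ₀) (h1 : θ₀ ≤ 1) :
    ∃ t ∈ 𝓝 θ₀, ∀ᶠ z in atTop, ∀ θ ∈ t,
      ENNReal.ofReal (μ.real {ω | z ≤ X ω} * max 0 (1 - θ) ^ a) ≤ tailMoment μ X a θ (κ * z) := by
  have hr : 0 < r := ha.trans har
  have hJ := tailConst_pos ha.le har
  have hlim1 : ContinuousAt (fun δ : ℝ => max 0 (1 - (θ₀ - δ)) ^ a) 0 :=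
    ContinuousAt.rpow_const (by fun_prop) (Or.inr ha.le)
  have hlim3 : ContinuousAt (fun δ : ℝ => (κ * (θ₀ + δ)) ^ (-r) - δ) 0 :=
    (ContinuousAt.rpow_const (by fun_prop) (Or.inl (by simp [hκ.ne', h0.ne']))).sub (by fun_prop)
  have hlim2 : ContinuousAt (fun δ : ℝ => (θ₀ + δ) ^ a * (tailConst a r - δ) *
      ((κ * (θ₀ + δ)) ^ (-r) - δ)) 0 :=
    ((ContinuousAt.rpow_const (by fun_prop) (Or.inr ha.le)).mul (by fun_prop)).mul hlim3
  have e1 := hlim1.eventually_lt hlim2 (by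
    simpa [max_eq_right (sub_nonneg.2 h1)] using one_sub_rpow_lt ha har hκ hκc h0 h1)
  have e3 := hlim3.eventually (lt_mem_nhds (by simpa using (by positivity) :
    (0 : ℝ) < (κ * (θ₀ + 0)) ^ (-r) - 0))
  obtain ⟨δ, ⟨⟨hδ1, hδ2⟩, hδ3⟩, hδ4⟩ := ((((e1.and e3).and (gt_mem_nhds hJ)).filter_mono
    (nhdsWithin_le_nhds (s := Ioi 0))).and self_mem_nhdsWithin).exists
  have hδ : 0 < δ := hδ4
  have hδJ : δ < tailConst a r := hδ3
  have hθ' : 0 < θ₀ + δ := by linarith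
  have hκθ : 0 < κ * (θ₀ + δ) := mul_pos hκ hθ'
  have hq := tendsto_measureReal_tail (μ := μ) hX
  refine ⟨Ioo (θ₀ - δ) (θ₀ + δ), Ioo_mem_nhds (by linarith) (by linarith), ?_⟩
  have e4 := (tendsto_id.atTop_mul_const hκθ).eventually (eventually_le_tailMoment hl.eventually_pos
    (tendsto_tailMoment_div_of_isLike hX ha har hl) (b := tailConst a r - δ) (by linarith)
    (by linarith))
  have e5 := (hl.tendsto_div hr hq hκθ).eventually (lt_mem_nhds (sub_lt_self _ hδ))
  filter_upwards [e4, e5, hl.eventually_pos] with z h4 h5 h6 θ hθ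
  rw [lt_div_iff₀ h6] at h5
  refine le_trans ?_ (tailMoment_anti ha (κ * z) hθ.2.le)
  simp only
  rw [tailMoment_eq_mul hθ', show κ * z * (θ₀ + δ) = z * (κ * (θ₀ + δ)) by ring]
  refine le_trans ?_ (mul_le_mul_right h4 _)
  rw [← ENNReal.ofReal_mul (by positivity)]
  refine ENNReal.ofReal_le_ofReal ?_
  have h7 : max 0 (1 - θ) ^ a ≤ max 0 (1 - (θ₀ - δ)) ^ a := by
    have := hθ.1
    gcongr
  have h8 : 0 ≤ tailConst a r - δ := by linarith
  calc μ.real {ω | z ≤ X ω} * max 0 (1 - θ) ^ a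
      ≤ μ.real {ω | z ≤ X ω} * ((θ₀ + δ) ^ a * (tailConst a r - δ) *
        ((κ * (θ₀ + δ)) ^ (-r) - δ)) := by
        gcongr
        exact h7.trans hδ1.le
    _ = (θ₀ + δ) ^ a * ((tailConst a r - δ) *
        (((κ * (θ₀ + δ)) ^ (-r) - δ) * μ.real {ω | z ≤ X ω})) := by ring
    _ ≤ _ := by
        gcongr
        exact h5.le

theorem eventually_le_P (hX : Measurable X) (h0 : α ≠ 0) (htop : α ≠ ⊤) {r : ℝ}
    (har : α.toReal < r) (hl : IsLike (fun x => μ.real {ω | x ≤ X ω}) (ENNReal.ofReal r))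
    {κ : ℝ} (hκ : 0 < κ) (hκc : κ ^ r < c r α.toReal) :
    ∀ᶠ z in atTop, ENNReal.ofReal (μ.real {ω | z ≤ X ω}) ≤ P μ X α (κ * z) := by
  have ha : 0 < α.toReal := ENNReal.toReal_pos h0 htop
  suffices H : ∀ᶠ z in atTop, ∀ θ < 1, ENNReal.ofReal (μ.real {ω | z ≤ X ω} *
      (1 - θ) ^ α.toReal) ≤ tailMoment μ X α.toReal θ (κ * z) by
    filter_upwards [H, eventually_gt_atTop 0] with z h1 hz
    exact le_P_of_le_tailMoment h0 htop (mul_pos hκ hz) h1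
  set a := α.toReal
  have hr : 0 < r := ha.trans har
  have hlimδ : Tendsto (fun δ : ℝ => δ ^ (r - a)) (𝓝[>] 0) (𝓝 0) := by
    refine Tendsto.mono_left ?_ nhdsWithin_le_nhds
    have := (Real.continuousAt_rpow_const 0 (r - a) (Or.inr (sub_pos.2 har).le)).tendsto
    rwa [Real.zero_rpow (sub_pos.2 har).ne'] at this
  -- This `δ` gives `δ^(-a) < (2κδ)^(-r)`, the limit of `q(2κδz)/q(z)`, so the Markov bound exceeds
  -- `q(z)(1 - θ)^a` for every `θ ≤ δ`.
  obtain ⟨δ, ⟨hδ1, hδ2⟩, hδ3⟩ := (((hlimδ.eventually (gt_mem_nhds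
    (by positivity : 0 < (2 * κ) ^ (-r)))).and self_mem_nhdsWithin).and
    (nhdsWithin_le_nhds (gt_mem_nhds zero_lt_one))).exists
  have hδ0 : 0 < δ := hδ2
  have hδ1' : δ < 1 := hδ3
  have hq := tendsto_measureReal_tail (μ := μ) hX
  have hκδ : 0 < κ * (2 * δ) := by positivity
  have hlt : δ ^ (-a) < (κ * (2 * δ)) ^ (-r) := by
    have h1 : κ * (2 * δ) = 2 * κ * δ := by ring
    rw [h1, Real.mul_rpow (by positivity) hδ0.le]
    calc δ ^ (-a) = δ ^ (r - a) * δ ^ (-r) := by rw [← Real.rpow_add hδ0]; congr 1; ring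
      _ < _ := by gcongr
  have e1 := (hl.tendsto_div hr hq hκδ).eventually (lt_mem_nhds hlt)
  have e2 : ∀ᶠ z in atTop, ∀ θ ∈ Icc δ 1, ENNReal.ofReal (μ.real {ω | z ≤ X ω} *
      max 0 (1 - θ) ^ a) ≤ tailMoment μ X a θ (κ * z) := by
    refine isCompact_Icc.induction_on (p := fun s => ∀ᶠ z in atTop, ∀ θ ∈ s,
      ENNReal.ofReal (μ.real {ω | z ≤ X ω} * max 0 (1 - θ) ^ a) ≤ tailMoment μ X a θ (κ * z))
      (by simp) ?_ ?_ ?_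
    · intro s t hst ht
      filter_upwards [ht] with z hz θ hθ using hz θ (hst hθ)
    · intro s t hs ht
      filter_upwards [hs, ht] with z h1 h2 θ hθ using hθ.elim (h1 θ) (h2 θ)
    · intro θ₀ hθ₀
      obtain ⟨t, ht, hz⟩ := exists_nhds_eventually_le_tailMoment hX ha har hl hκ hκc
        (hδ0.trans_le hθ₀.1) hθ₀.2
      exact ⟨t, nhdsWithin_le_nhds ht, hz⟩
  filter_upwards [e1, e2, hl.eventually_pos, eventually_gt_atTop 0] with z h1 h2 h3 hz θ hθ
  rcases le_total δ θ with h4 | h4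
  · have h5 := h2 θ ⟨h4, hθ.le⟩
    rwa [max_eq_right (sub_nonneg.2 hθ.le)] at h5
  · refine le_trans ?_ (mul_measureReal_le_tailMoment hX ha (mul_pos hκ hz) hδ0 hδ1'.le h4)
    refine ENNReal.ofReal_le_ofReal ?_
    rw [lt_div_iff₀ h3, Real.rpow_neg hδ0.le, inv_mul_lt_iff₀ (by positivity)] at h1
    have h5 : 0 ≤ (1 - θ) ^ a := Real.rpow_nonneg (sub_nonneg.2 hθ.le) a
    rw [show κ * z * (2 * δ) = z * (κ * (2 * δ)) by ring]
    calc μ.real {ω | z ≤ X ω} * (1 - θ) ^ a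
        ≤ δ ^ a * μ.real {ω | z * (κ * (2 * δ)) ≤ X ω} * (1 - θ) ^ a := by
          gcongr
      _ = _ := by ring

end QuantileBounds

/-! ### Elementary properties of `h`, `P` and `Q`. -/

namespace QuantileBounds

theorem h_zero_left (u : ℝ) : h 0 u = if 0 ≤ u then 1 else 0 := if_pos rfl

theorem h_mono (α : ℝ≥0∞) : Monotone (h α) := by
  intro u v huv
  unfold h
  split_ifs with h1 h2 h3 h4
  · exact le_rfl
  · exact absurd (h2.trans huv) h3
  · exact zero_le_one
  · exact le_rfl
  · exact Real.exp_le_exp.2 huv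
  · gcongr

theorem h_nonneg (α : ℝ≥0∞) (u : ℝ) : 0 ≤ h α u := by
  unfold h
  split_ifs
  · exact zero_le_one
  · exact le_rfl
  · exact (Real.exp_pos u).le
  · positivity

theorem h_zero_le (α : ℝ≥0∞) (u : ℝ) : h 0 u ≤ h α u := by
  rw [h_zero_left]
  split_ifs with hu
  · refine le_trans ?_ (h_mono α hu)
    unfold h
    split_ifs <;> norm_num at *
  · exact h_nonneg α u

theorem tendsto_h_atBot (α : ℝ≥0∞) : Tendsto (h α) atBot (𝓝 0) := by
  by_cases h0 : α = 0
  · refine tendsto_const_nhds.congr' ?_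
    filter_upwards [eventually_lt_atBot 0] with u hu
    rw [h0, h_zero_left, if_neg (not_le.2 hu)]
  by_cases htop : α = ⊤
  · refine Real.tendsto_exp_atBot.congr fun u => ?_
    simp [h, htop]
  · have ha : 0 < α.toReal := ENNReal.toReal_pos h0 htop
    refine tendsto_const_nhds.congr' ?_
    filter_upwards [eventually_lt_atBot (-α.toReal)] with u hu
    have h1 : 1 + u / α.toReal ≤ 0 := by
      have h2 : u / α.toReal ≤ -1 := by
        rw [div_le_iff₀ ha]
        linarith
      linarith
    simp only [h, h0, htop, if_false]
    rw [max_eq_left h1, Real.zero_rpow ha.ne']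

variable {Ω : Type*} [MeasurableSpace Ω] {μ : Measure Ω} {X : Ω → ℝ} {α : ℝ≥0∞}

theorem A_zero (hX : Measurable X) {x l : ℝ} (hl : 0 < l) : A μ X 0 x l = μ {ω | x ≤ X ω} := by
  unfold A
  rw [← lintegral_indicator_one (measurableSet_le measurable_const hX)]
  refine lintegral_congr fun ω => ?_
  rw [h_zero_left]
  by_cases hω : x ≤ X ω
  · rw [if_pos (mul_nonneg hl.le (sub_nonneg.2 hω)), indicator_of_mem (by exact hω)]
    simp
  · rw [if_neg (not_le.2 (mul_neg_of_pos_of_neg hl (by linarith))),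
      indicator_of_notMem (by exact hω)]
    simp

theorem P_zero (hX : Measurable X) (x : ℝ) : P μ X 0 x = μ {ω | x ≤ X ω} :=
  le_antisymm ((iInf₂_le 1 (mem_Ioi.2 one_pos)).trans_eq (A_zero hX one_pos))
    (le_iInf₂ fun _ hl => (A_zero hX hl).ge)

theorem P_antitone : Antitone (P μ X α) := by
  intro x y hxy
  refine iInf₂_mono fun l hl => lintegral_mono fun ω => ENNReal.ofReal_le_ofReal (h_mono α ?_)
  have : (0 : ℝ) < l := hl
  gcongr

theorem tail_le_P (hX : Measurable X) (x : ℝ) : μ {ω | x ≤ X ω} ≤ P μ X α x := by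
  rw [← P_zero hX]
  exact iInf₂_mono fun l _ => lintegral_mono fun ω => ENNReal.ofReal_le_ofReal (h_zero_le α _)

theorem P_eq_zero_of_ae_le [IsProbabilityMeasure μ] {b x : ℝ} (hb : ∀ᵐ ω ∂μ, X ω ≤ b)
    (hx : b < x) : P μ X α x = 0 := by
  have h1 : ∀ l : ℝ, 0 < l → P μ X α x ≤ ENNReal.ofReal (h α (l * (b - x))) := by
    intro l hl
    refine (iInf₂_le l (mem_Ioi.2 hl)).trans ?_
    calc A μ X α x l ≤ ∫⁻ _, ENNReal.ofReal (h α (l * (b - x))) ∂μ := by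
          refine lintegral_mono_ae ?_
          filter_upwards [hb] with ω hω
          refine ENNReal.ofReal_le_ofReal (h_mono α ?_)
          gcongr
      _ = _ := by simp
  -- Since `b - x < 0`, letting `l → ∞` sends the argument of `h α` to `-∞`.
  have h2 : Tendsto (fun l : ℝ => ENNReal.ofReal (h α (l * (b - x)))) atTop (𝓝 0) := by
    rw [← ENNReal.ofReal_zero]
    exact ENNReal.tendsto_ofReal ((tendsto_h_atBot α).comp
      (tendsto_id.atTop_mul_const_of_neg (sub_neg.2 hx)))
  refine le_antisymm (ge_of_tendsto h2 ?_) zero_le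
  filter_upwards [eventually_gt_atTop 0] with l hl using h1 l hl

theorem Q_le_of_P_lt {p x : ℝ} (hx : P μ X α x < ENNReal.ofReal p) : Q μ X α p ≤ x :=
  sInf_le ⟨x, hx, rfl⟩

theorem le_Q_of_le_tail (hX : Measurable X) {p m : ℝ}
    (hp : ENNReal.ofReal p ≤ μ {ω | m ≤ X ω}) : (m : EReal) ≤ Q μ X α p := by
  refine le_sInf ?_
  rintro _ ⟨x, hx, rfl⟩
  refine EReal.coe_le_coe_iff.2 (le_of_not_gt fun hxm => ?_)
  exact (hp.trans ((antitone_measure_tail hxm.le).trans (tail_le_P hX x))).not_gt hx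

theorem eventually_le_Q [IsProbabilityMeasure μ] (hX : Measurable X) {m : ℝ}
    (hm : 0 < μ {ω | m ≤ X ω}) :
    ∀ᶠ p in 𝓝[>] (0 : ℝ), (m : EReal) ≤ Q μ X α p := by
  filter_upwards [nhdsWithin_le_nhds (gt_mem_nhds
    (ENNReal.toReal_pos hm.ne' (measure_ne_top μ _)))] with p hp
  exact le_Q_of_le_tail hX (ENNReal.ofReal_le_of_le_toReal hp.le)

/-! ### The supremum of the support and part (i). -/

section Support

theorem ae_le_xStar (hX : Measurable X) : ∀ᵐ ω ∂μ, (X ω : EReal) ≤ xStar μ X := by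
  have h1 : ∀ᵐ x ∂(μ.map X), x ∈ (μ.map X).support := Measure.support_mem_ae
  filter_upwards [ae_of_ae_map hX.aemeasurable h1] with ω hω
  exact le_sSup ⟨X ω, hω, rfl⟩

theorem tail_pos_of_lt_xStar (hX : Measurable X) {m : ℝ} (hm : (m : EReal) < xStar μ X) :
    0 < μ {ω | m ≤ X ω} := by
  obtain ⟨_, ⟨x, hx, rfl⟩, hmx⟩ := lt_sSup_iff.1 hm
  have h1 : 0 < (μ.map X) (Ici m) :=
    Measure.mem_support_iff_forall x |>.1 hx _ (Ici_mem_nhds (EReal.coe_lt_coe_iff.1 hmx))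
  rwa [Measure.map_apply hX measurableSet_Ici] at h1

theorem xStar_eq_top (hX : Measurable X) (hpos : ∀ x, 0 < μ {ω | x ≤ X ω}) :
    xStar μ X = ⊤ := by
  by_contra hne
  obtain ⟨b, hb, -⟩ := EReal.lt_iff_exists_real_btwn.1 (lt_top_iff_ne_top.2 hne)
  have hle : ∀ᵐ ω ∂μ, ¬ b ≤ X ω := by
    filter_upwards [ae_le_xStar (μ := μ) hX] with ω hω
    exact not_le.2 (EReal.coe_lt_coe_iff.1 (hω.trans_lt hb))
  have h1 := hpos b
  rw [ae_iff] at hle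
  simp only [not_not] at hle
  exact h1.ne' hle

variable [IsProbabilityMeasure μ]

theorem xStar_ne_bot (hX : Measurable X) : xStar μ X ≠ ⊥ := by
  obtain ⟨ω, hω⟩ := (ae_le_xStar (μ := μ) hX).exists
  exact ((EReal.bot_lt_coe _).trans_le hω).ne'

theorem tendsto_Q_xStar (hX : Measurable X) {b : ℝ} (hb : xStar μ X = b) :
    Tendsto (fun p : ℝ => Q μ X α p) (𝓝[>] 0) (𝓝 (xStar μ X)) := by
  have hle : ∀ᵐ ω ∂μ, X ω ≤ b := by
    filter_upwards [ae_le_xStar (μ := μ) hX] with ω hω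
    rw [hb] at hω
    exact EReal.coe_le_coe_iff.1 hω
  refine tendsto_order.2 ⟨fun u hu => ?_, fun u hu => ?_⟩
  · obtain ⟨m, hum, hm⟩ := EReal.lt_iff_exists_real_btwn.1 hu
    filter_upwards [eventually_le_Q (α := α) hX (tail_pos_of_lt_xStar hX hm)] with p hp
    exact hum.trans_le hp
  · obtain ⟨x, hx, hxu⟩ := EReal.lt_iff_exists_real_btwn.1 hu
    rw [hb] at hx
    filter_upwards [self_mem_nhdsWithin] with p hp
    refine lt_of_le_of_lt (Q_le_of_P_lt ?_) hxu
    rw [P_eq_zero_of_ae_le hle (EReal.coe_lt_coe_iff.1 hx)]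
    exact ENNReal.ofReal_pos.2 hp

end Support

/-! ### From tail comparison to quantile asymptotics. -/

theorem exists_Q_eq_coe [IsProbabilityMeasure μ] (hX : Measurable X) {p : ℝ} (hp : p < 1)
    (hne : ∃ x, P μ X α x < ENNReal.ofReal p) :
    ∃ a : ℝ, Q μ X α p = a ∧ IsGLB {x : ℝ | P μ X α x < ENNReal.ofReal p} a := by
  obtain ⟨x₀, hx₀⟩ := hne
  have hm : ∃ m : ℝ, ENNReal.ofReal p ≤ μ {ω | m ≤ X ω} := by
    have h1 : Tendsto (fun x => μ {ω | x ≤ X ω}) atBot (𝓝 (μ (⋃ x : ℝ, {ω | x ≤ X ω}))) :=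
      tendsto_measure_iUnion_atBot fun x y h ω hω => le_trans h hω
    have h2 : (⋃ x : ℝ, {ω | x ≤ X ω}) = univ := by
      ext ω
      simp only [mem_iUnion, mem_ofPred_eq, mem_univ, iff_true]
      exact ⟨X ω, le_rfl⟩
    rw [h2, measure_univ] at h1
    obtain ⟨m, hm⟩ := (h1.eventually (lt_mem_nhds (ENNReal.ofReal_lt_one.2 hp))).exists
    exact ⟨m, hm.le⟩
  obtain ⟨m, hm⟩ := hm
  have h1 : Q μ X α p ≠ ⊤ := ((Q_le_of_P_lt hx₀).trans_lt (EReal.coe_lt_top _)).ne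
  have h2 : Q μ X α p ≠ ⊥ := ((EReal.bot_lt_coe m).trans_le (le_Q_of_le_tail hX hm)).ne'
  refine ⟨(Q μ X α p).toReal, (EReal.coe_toReal h1 h2).symm, fun x hx => ?_, fun y hy => ?_⟩
  · rw [← EReal.coe_le_coe_iff, EReal.coe_toReal h1 h2]
    exact Q_le_of_P_lt hx
  · rw [← EReal.coe_le_coe_iff, EReal.coe_toReal h1 h2]
    refine le_sInf ?_
    rintro _ ⟨x, hx, rfl⟩
    exact EReal.coe_le_coe_iff.2 (hy hx)

theorem Q_asymptotics [IsProbabilityMeasure μ] (hX : Measurable X) {k : ℝ} (hk : 0 < k)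
    (hpos : ∀ x, 0 < μ {ω | x ≤ X ω})
    (hU : ∀ κ, k < κ → ∀ᶠ z in atTop, P μ X α (κ * z) ≤ μ {ω | z ≤ X ω})
    (hL : ∀ κ, 0 < κ → κ < k → ∀ᶠ z in atTop, μ {ω | z ≤ X ω} ≤ P μ X α (κ * z)) :
    (∀ p ∈ Ioo (0 : ℝ) 1,
      (∃ a : ℝ, Q μ X α p = (a : EReal)) ∧ (∃ b : ℝ, Q μ X 0 p = (b : EReal))) ∧
    Tendsto (fun p : ℝ => Q μ X α p) (𝓝[>] 0) (𝓝 ⊤) ∧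
    Tendsto (fun p : ℝ => (Q μ X α p).toReal / (k * (Q μ X 0 p).toReal)) (𝓝[>] 0) (𝓝 1) := by
  have hsmall : ∀ p : ℝ, 0 < p → ∀ᶠ z in atTop, μ {ω | z ≤ X ω} < ENNReal.ofReal p := by
    intro p hp
    filter_upwards [(tendsto_measureReal_tail (μ := μ) hX).eventually (gt_mem_nhds hp)] with z hz
    rw [← ofReal_measureReal]
    exact (ENNReal.ofReal_lt_ofReal_iff hp).2 hz
  have hGLB0 : ∀ p ∈ Ioo (0 : ℝ) 1, ∃ b : ℝ, Q μ X 0 p = b ∧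
      IsGLB {x : ℝ | P μ X 0 x < ENNReal.ofReal p} b := by
    intro p hp
    obtain ⟨z, hz⟩ := (hsmall p hp.1).exists
    exact exists_Q_eq_coe hX hp.2 ⟨z, by rwa [P_zero hX]⟩
  have hGLB : ∀ p ∈ Ioo (0 : ℝ) 1, ∃ a : ℝ, Q μ X α p = a ∧
      IsGLB {x : ℝ | P μ X α x < ENNReal.ofReal p} a := by
    intro p hp
    obtain ⟨z, hz1, hz2⟩ := ((hsmall p hp.1).and (hU (k + 1) (lt_add_one k))).exists
    exact exists_Q_eq_coe hX hp.2 ⟨_, hz2.trans_lt hz1⟩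
  have htop : ∀ β : ℝ≥0∞, ∀ m : ℝ, ∀ᶠ p in 𝓝[>] (0 : ℝ), (m : EReal) ≤ Q μ X β p :=
    fun β m => eventually_le_Q hX (hpos m)
  have hmem : ∀ᶠ p in 𝓝[>] (0 : ℝ), p ∈ Ioo (0 : ℝ) 1 := Ioo_mem_nhdsGT one_pos
  have hupper : ∀ κ, k < κ → ∀ᶠ p in 𝓝[>] (0 : ℝ),
      (Q μ X α p).toReal ≤ κ * (Q μ X 0 p).toReal := by
    intro κ hκ
    have hκ0 : 0 < κ := hk.trans hκ
    obtain ⟨z₀, hz₀⟩ := eventually_atTop.1 (hU κ hκ)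
    filter_upwards [hmem, htop 0 z₀] with p hp h1
    obtain ⟨a, ha, haS⟩ := hGLB p hp
    obtain ⟨b, hb, hbS⟩ := hGLB0 p hp
    rw [hb, EReal.coe_le_coe_iff] at h1
    rw [ha, hb, EReal.toReal_coe, EReal.toReal_coe, ← div_le_iff₀' hκ0]
    -- Work at `z > b = Q_0`: at `b` itself the tail may still be at least `p`.
    refine le_of_forall_gt_imp_ge_of_dense fun z hz => ?_
    obtain ⟨x, hx, -, hxz⟩ := hbS.exists_between hz
    rw [div_le_iff₀' hκ0]
    refine haS.1 ?_
    refine lt_of_le_of_lt ((hz₀ z (h1.trans hz.le)).trans ?_) hx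
    rw [P_zero hX]
    exact antitone_measure_tail hxz.le
  have hlower : ∀ κ, 0 < κ → κ < k → ∀ᶠ p in 𝓝[>] (0 : ℝ),
      κ * (Q μ X 0 p).toReal ≤ (Q μ X α p).toReal := by
    intro κ hκ0 hκ
    obtain ⟨z₀, hz₀⟩ := eventually_atTop.1 (hL κ hκ0 hκ)
    -- The extra `1` makes `z₀ < b` strict; then `x < κb` would put `max (x / κ) z₀`, a point with
    -- tail below `p`, strictly under `b`.
    filter_upwards [hmem, htop 0 (z₀ + 1)] with p hp h1
    obtain ⟨a, ha, haS⟩ := hGLB p hp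
    obtain ⟨b, hb, hbS⟩ := hGLB0 p hp
    rw [hb, EReal.coe_le_coe_iff] at h1
    rw [ha, hb, EReal.toReal_coe, EReal.toReal_coe]
    refine haS.2 fun x hx => le_of_not_gt fun hxb => ?_
    have h2 : max (x / κ) z₀ < b := max_lt ((div_lt_iff₀' hκ0).2 hxb) (by linarith)
    refine (hbS.1 (?_ : max (x / κ) z₀ ∈ _)).not_gt h2
    change P μ X 0 _ < _
    rw [P_zero hX]
    refine lt_of_le_of_lt ((hz₀ _ (le_max_right _ _)).trans (P_antitone ?_)) hx
    rw [← div_le_iff₀' hκ0]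
    exact le_max_left _ _
  have hbpos : ∀ᶠ p in 𝓝[>] (0 : ℝ), 0 < (Q μ X 0 p).toReal := by
    filter_upwards [hmem, htop 0 1] with p hp h1
    obtain ⟨b, hb, -⟩ := hGLB0 p hp
    rw [hb, EReal.coe_le_coe_iff] at h1
    rw [hb, EReal.toReal_coe]
    linarith
  refine ⟨fun p hp => ⟨?_, ?_⟩, ?_, ?_⟩
  · obtain ⟨a, ha, -⟩ := hGLB p hp
    exact ⟨a, ha⟩
  · obtain ⟨b, hb, -⟩ := hGLB0 p hp
    exact ⟨b, hb⟩
  · refine EReal.tendsto_nhds_top_iff_real.2 fun m => ?_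
    filter_upwards [htop α (m + 1)] with p hp
    exact (EReal.coe_lt_coe_iff.2 (lt_add_one m)).trans_le hp
  · refine tendsto_order.2 ⟨fun u hu => ?_, fun u hu => ?_⟩
    · obtain ⟨v, hv1, hv2⟩ := exists_between (max_lt hu zero_lt_one)
      have hv0 : 0 < v := (le_max_right _ _).trans_lt hv1
      filter_upwards [hbpos, hlower (v * k) (mul_pos hv0 hk) (by nlinarith)] with p h1 h2
      refine ((le_max_left _ _).trans_lt hv1).trans_le ?_
      rw [le_div_iff₀ (mul_pos hk h1), ← mul_assoc]
      exact h2
    · obtain ⟨v, hv1, hv2⟩ := exists_between hu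
      filter_upwards [hbpos, hupper (v * k) (by nlinarith)] with p h1 h2
      refine lt_of_le_of_lt ?_ hv2
      rw [div_le_iff₀ (mul_pos hk h1), ← mul_assoc]
      exact h2

theorem eventually_P_zero_le (hX : Measurable X) {κ : ℝ} (hκ : 1 ≤ κ) :
    ∀ᶠ z in atTop, P μ X 0 (κ * z) ≤ μ {ω | z ≤ X ω} := by
  filter_upwards [eventually_ge_atTop 0] with z hz
  rw [P_zero hX]
  exact antitone_measure_tail (le_mul_of_one_le_left hz hκ)

theorem eventually_tail_le_P (hX : Measurable X) {κ : ℝ} (hκ : κ ≤ 1) :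
    ∀ᶠ z in atTop, μ {ω | z ≤ X ω} ≤ P μ X α (κ * z) := by
  filter_upwards [eventually_ge_atTop 0] with z hz
  exact (antitone_measure_tail (mul_le_of_le_one_left hz hκ)).trans (tail_le_P hX _)

theorem tail_pos_of_isLike [IsProbabilityMeasure μ] {r : ℝ≥0∞}
    (hl : IsLike (fun x => μ.real {ω | x ≤ X ω}) r) (x : ℝ) : 0 < μ {ω | x ≤ X ω} := by
  obtain ⟨y, hy1, hy2⟩ := (hl.eventually_pos.and (eventually_ge_atTop x)).exists
  exact (ENNReal.toReal_pos_iff.1 hy1).1.trans_le (antitone_measure_tail hy2)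

theorem K_zero_right {r : ℝ≥0∞} (hr : 0 < r) : K r 0 = 1 := by
  unfold K
  split_ifs with htop
  · rfl
  · rw [ENNReal.toReal_zero, c_zero_right (ENNReal.toReal_pos hr.ne' htop), Real.one_rpow]

end QuantileBounds

open QuantileBounds in
theorem QuantileBounds.Q_asymptotics_of_isLike {Ω : Type*} [MeasurableSpace Ω] {μ : Measure Ω}
    [IsProbabilityMeasure μ] {X : Ω → ℝ} (hX : Measurable X) {α r : ℝ≥0∞} (hαr : α < r)
    (hl : IsLike (fun x => μ.real {ω | x ≤ X ω}) r) :
    (∀ p ∈ Ioo (0 : ℝ) 1,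
      (∃ a : ℝ, Q μ X α p = (a : EReal)) ∧ (∃ b : ℝ, Q μ X 0 p = (b : EReal))) ∧
    Tendsto (fun p : ℝ => Q μ X α p) (𝓝[>] 0) (𝓝 ⊤) ∧
    Tendsto (fun p : ℝ => (Q μ X α p).toReal / (K r α * (Q μ X 0 p).toReal)) (𝓝[>] 0) (𝓝 1) := by
  have hpos := tail_pos_of_isLike hl
  have htop : α ≠ ⊤ := ne_top_of_lt hαr
  by_cases h0 : α = 0
  · subst h0
    rw [K_zero_right hαr]
    exact Q_asymptotics hX one_pos hpos (fun κ hκ => eventually_P_zero_le hX hκ.le)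
      (fun κ _ hκ => eventually_tail_le_P hX hκ.le)
  by_cases hr : r = ⊤
  · subst hr
    rw [show K ⊤ α = 1 from if_pos rfl]
    -- As `K = 1`, the lower comparison has `κ < 1` and needs only `P(X ≥ x) ≤ P_α(X; x)`.
    refine Q_asymptotics hX one_pos hpos (fun κ hκ => ?_)
      (fun κ _ hκ => eventually_tail_le_P hX hκ.le)
    filter_upwards [eventually_P_le_top hX h0 htop hl hκ] with z hz
    rwa [ofReal_measureReal] at hz
  · have har : α.toReal < r.toReal := ENNReal.toReal_strict_mono hr hαr
    have hr0 : 0 < r.toReal := ENNReal.toReal_nonneg.trans_lt har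
    have hc := c_pos ENNReal.toReal_nonneg har
    rw [show K r α = (c r.toReal α.toReal) ^ (1 / r.toReal) from if_neg hr, one_div]
    rw [← ENNReal.ofReal_toReal hr] at hl
    have hK : 0 < c r.toReal α.toReal ^ r.toReal⁻¹ := Real.rpow_pos_of_pos hc _
    refine Q_asymptotics hX hK hpos (fun κ hκ => ?_) (fun κ hκ0 hκ => ?_)
    · filter_upwards [eventually_P_le hX h0 htop har hl (hK.trans hκ)
        ((Real.rpow_inv_lt_iff_of_pos hc.le (hK.trans hκ).le hr0).1 hκ)] with z hz
      rwa [ofReal_measureReal] at hz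
    · filter_upwards [eventually_le_P hX h0 htop har hl hκ0
        ((Real.lt_rpow_inv_iff_of_pos hκ0.le hc.le hr0).1 hκ)] with z hz
      rwa [ofReal_measureReal] at hz

theorem mainTheorem5 {Ω : Type*} [MeasurableSpace Ω] (μ : Measure Ω) [IsProbabilityMeasure μ]
    (X : Ω → ℝ) (hX : Measurable X) (α : ℝ≥0∞) :
    (QuantileBounds.xStar μ X < ⊤ →
      (∃ b : ℝ, QuantileBounds.xStar μ X = (b : EReal)) ∧
      Tendsto (fun p : ℝ => QuantileBounds.Q μ X α p) (𝓝[>] 0)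
        (𝓝 (QuantileBounds.xStar μ X)) ∧
      Tendsto (fun p : ℝ => QuantileBounds.Q μ X 0 p) (𝓝[>] 0)
        (𝓝 (QuantileBounds.xStar μ X))) ∧
    (∀ r : ℝ≥0∞, α < r → QuantileBounds.IsLike (fun x => μ.real {ω | x ≤ X ω}) r →
      QuantileBounds.xStar μ X = ⊤ ∧
      (∀ p ∈ Ioo (0 : ℝ) 1,
        (∃ a : ℝ, QuantileBounds.Q μ X α p = (a : EReal)) ∧
        (∃ b : ℝ, QuantileBounds.Q μ X 0 p = (b : EReal))) ∧
      Tendsto (fun p : ℝ => QuantileBounds.Q μ X α p) (𝓝[>] 0) (𝓝 ⊤) ∧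
      Tendsto (fun p : ℝ => (QuantileBounds.Q μ X α p).toReal /
          (QuantileBounds.K r α * (QuantileBounds.Q μ X 0 p).toReal))
        (𝓝[>] 0) (𝓝 1)) := by
  refine ⟨fun htop => ?_, fun r hαr hl => ⟨QuantileBounds.xStar_eq_top hX
    (QuantileBounds.tail_pos_of_isLike hl), QuantileBounds.Q_asymptotics_of_isLike hX hαr hl⟩⟩
  have hb := (EReal.coe_toReal htop.ne (QuantileBounds.xStar_ne_bot hX)).symm
  exact ⟨⟨_, hb⟩, QuantileBounds.tendsto_Q_xStar hX hb, QuantileBounds.tendsto_Q_xStar hX hb⟩
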